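/- Let $k$ be a field and $R$ a local artinian $k$-algebra, finite-dimensional over $k$, with maximal ideal $\mathfrak m$ (for instance, with residue field $k$). Let $V=R((z))$, $V^+=R[[z]]$ and let $K$ be either $k$ or $R$. For $f\in R((z))^*$, consider the $K$-submodules $M\subseteq V^+\cap fV^+$ that are neighbourhoods of $0$ in the $z$-adic topology and such that $V^+/M$ and $fV^+/M$ are free over $K$. A lift $(\sigma,f)$ of $f$ is a $K$-linear isomorphism of determinant lines $\sigma_M:\bigwedge^{\max}(fV^+/M)\to\bigwedge^{\max}(V^+/M)$ for each such $M$, compatible, for $M'\subseteq M$, with the canonical isomorphisms $\bigwedge^{\max}(A/M)\otimes\bigwedge^{\max}(M/M')\simeq\bigwedge^{\max}(A/M')$, where $A$ is $V^+$ or $fV^+$ (equivalently, $\sigma$ is an isomorphism $(f^{-1})^*\mathbb D\to\mathbb D$, where $\mathbb D$ is the determinant bundle on the infinite Grassmannian of $(V,V^+)$ with fibre $\bigwedge(U\cap V^+)\otimes\bigwedge(V/(U+V^+))^*$ at $U$). Lifts are multiplied by $(\sigma,f)(\tau,g)=(\sigma\circ f(\tau),fg)$, where $f(\tau)$ is $\tau$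 transported along multiplication by $f$. This gives a central extension by $K^*$ of the group of those $f\in R((z))^*$ that reduce to $1$ modulo $\mathfrak m$. Its commutator $\langle f,g\rangle_K\in K^*$ is defined by $\tilde f\tilde g=\langle f,g\rangle_K\,\tilde g\tilde f$ for all lifts $\tilde f,\tilde g$ of $f,g$. Let $$f=\prod_{i>0}(1-\bar a_iz^{-i})\prod_{i\ge 0}(1-a_iz^i),\qquad g=\prod_{i>0}(1-\bar b_iz^{-i})\prod_{i\ge 0}(1-b_iz^i)$$ in $R((z))$, where $a_i,b_i\in\mathfrak m$ for all $i\ge 0$, and the $\bar a_i,\bar b_i$ are nilpotent and almost all zero. Then in the products $$P=\prod_{i,j>0}\Big(1-a_i^{\frac{j}{(i,j)}}\,\bar b_j^{\frac{i}{(i,j)}}\Big)^{(i,j)},\qquad Q=\prod_{i,j>0}\Big(1-b_i^{\frac{j}{(i,j)}}\,\bar a_j^{\frac{i}{(i,j)}}\Big)^{(i,j)}$$ almost all factors are $1$, $P$ and $Q$ are units of $R$, lifts of $f$ and $g$ and their products exist, and $$\langle f,g\rangle_R=\frac PQ,\qquad \langle f,g\rangle_k=\operatorname{Norm}_{R/k}\Big(\frac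 PQ\Big).$$ -/

import Mathlib

open scoped LaurentSeries PowerSeries

noncomputable section

namespace ContouCarrere

/-! ### Determinant lines of quotients of submodules -/

section Det

variable (K : Type*) [CommRing K] {V : Type*} [AddCommGroup V] [Module K V]

/-- The quotient module `A / M` of two submodules of `V` (used for `M ≤ A`). -/
abbrev RelQuot (A M : Submodule K V) : Type _ := A ⧸ M.submoduleOf A

/-- The determinant `⋀ (A / M)`: the exterior power of maximal degree of `A / M`
(used when `A / M` is a finite free module, so that this is a free module of rank one). -/
abbrev DetLine (A M : Submodule K V) : Type _ :=
  ⋀[K]^(Module.finrank K (RelQuot K A M)) (RelQuot K A M)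

variable {K}

/-- The projection `A / M' → A / M` for `M' ≤ M`. -/
def relProj (A : Submodule K V) {M M' : Submodule K V} (h : M' ≤ M) :
    RelQuot K A M' →ₗ[K] RelQuot K A M :=
  Submodule.mapQ _ _ LinearMap.id (fun _ hx => h hx)

/-- The map `M / M' → A / M'` for `M ≤ A`. -/
def relIncl {A M : Submodule K V} (M' : Submodule K V) (h : M ≤ A) :
    RelQuot K M M' →ₗ[K] RelQuot K A M' :=
  Submodule.mapQ _ _ (Submodule.inclusion h) (fun _ hx => hx)

/-- The isomorphism `A / M ≃ A' / M'` induced by an automorphism `e` of `V` with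
`e A = A'` and `e M = M'`. -/
def relEquiv (e : V ≃ₗ[K] V) {A A' M M' : Submodule K V}
    (hA : A.map (e : V →ₗ[K] V) = A') (hM : M.map (e : V →ₗ[K] V) = M') :
    RelQuot K A M ≃ₗ[K] RelQuot K A' M' :=
  Submodule.Quotient.equiv _ _ (e.ofSubmodules A A' hA) (by
    subst hA hM
    ext ⟨y, hy⟩
    simp only [Submodule.mem_map, Submodule.submoduleOf, Submodule.mem_comap,
      Submodule.subtype_apply]
    constructor
    · rintro ⟨x, hx, hxy⟩
      exact ⟨x, hx, congrArg Subtype.val hxy⟩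
    · rintro ⟨x, hx, hxy⟩
      obtain ⟨x', hx', hxy'⟩ := hy
      have : x = x' := e.injective (hxy.trans hxy'.symm)
      subst this
      exact ⟨⟨x, hx'⟩, hx, Subtype.ext hxy⟩)

/-- The map `⋀ (A / M) → ⋀ (A' / M')` of determinant lines induced by an automorphism `e` of `V`
with `e A = A'` and `e M = M'`. -/
def detTransport (e : V ≃ₗ[K] V) {A A' M M' : Submodule K V}
    (hA : A.map (e : V →ₗ[K] V) = A') (hM : M.map (e : V →ₗ[K] V) = M') :
    DetLine K A M →ₗ[K] DetLine K A' M' :=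
  (LinearEquiv.ofEq
      (⋀[K]^(Module.finrank K (RelQuot K A M)) (RelQuot K A' M'))
      (⋀[K]^(Module.finrank K (RelQuot K A' M')) (RelQuot K A' M'))
      (by rw [(relEquiv e hA hM).finrank_eq])).toLinearMap ∘ₗ
    exteriorPower.map (Module.finrank K (RelQuot K A M)) (relEquiv e hA hM).toLinearMap

end Det

/-! ### The determinant central extension of the loop group

`R` is a `K`-algebra, `V = R((z))` and `V⁺ = R[[z]]` are regarded as `K`-modules. -/

section Extension

variable (K : Type*) [CommRing K] {R : Type*} [CommRing R] [Algebra K R]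

variable (R) in
/-- The `K`-submodule `z ^ N R[[z]]` of `R((z))`. -/
def lattice (N : ℤ) : Submodule K R⸨X⸩ where
  carrier := {v | ∀ n : ℤ, n < N → v.coeff n = 0}
  add_mem' := by
    intro u v hu hv n hn
    simp [hu n hn, hv n hn]
  zero_mem' := by
    intro n _
    simp
  smul_mem' := by
    intro c v hv n hn
    simp [hv n hn]

variable (R) in
/-- The `K`-submodule `V⁺ = R[[z]]` of `V = R((z))`. -/
abbrev Vplus : Submodule K R⸨X⸩ := lattice K R 0

/-- The homothety of ratio `f`, as a `K`-linear automorphism of `R((z))`. -/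
def homothety (f : R⸨X⸩ˣ) : R⸨X⸩ ≃ₗ[K] R⸨X⸩ where
  toFun v := (f : R⸨X⸩) * v
  invFun v := (↑f⁻¹ : R⸨X⸩) * v
  left_inv v := by simp
  right_inv v := by simp
  map_add' u v := mul_add _ u v
  map_smul' c v := by
    have h : ∀ w : R⸨X⸩, c • w = (HahnSeries.C (algebraMap K R c) : R⸨X⸩) * w := by
      intro w
      ext n
      simp [Algebra.smul_def]
    simp only [h, RingHom.id_apply]
    ring

/-- The submodule `f V⁺`. -/
abbrev mulVplus (f : R⸨X⸩ˣ) : Submodule K R⸨X⸩ :=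
  (Vplus K R).map (homothety K f : R⸨X⸩ →ₗ[K] R⸨X⸩)

lemma map_mulVplus {f g h : R⸨X⸩ˣ} (e : h = f * g) :
    (mulVplus K g).map (homothety K f : R⸨X⸩ →ₗ[K] R⸨X⸩) = mulVplus K h := by
  subst e
  rw [mulVplus, mulVplus, ← Submodule.map_comp]
  congr 1
  ext1 v
  simp [homothety, mul_assoc]

/-- The submodules `M` through which `V⁺` and `f V⁺` are compared: `M` is contained in both, is a
neighbourhood of `0` for the `z`-adic topology, and both quotients `V⁺ / M`, `f V⁺ / M` are
free. -/
structure Admissible (f : R⸨X⸩ˣ) (M : Submodule K R⸨X⸩) : Prop where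
  le_left : M ≤ Vplus K R
  le_right : M ≤ mulVplus K f
  isOpen : ∃ N : ℤ, lattice K R N ≤ M
  free_left : Module.Free K (RelQuot K (Vplus K R) M)
  free_right : Module.Free K (RelQuot K (mulVplus K f) M)

/-- A point `(σ, f)` over `f` of the central extension defined by the determinant bundle `𝔻`, whose
fibre at `U` is `⋀ (U ∩ V⁺) ⊗ (⋀ V / (U + V⁺))*`.

The pull back `(f⁻¹)* 𝔻` has fibre `Det (f⁻¹ U → V / V⁺) = Det (U → V / f V⁺)` at `U`, so for all
`M` as above `(f⁻¹)* 𝔻 = 𝔻 ⊗ ⋀ (f V⁺ / M) ⊗ (⋀ (V⁺ / M))*`, and an isomorphism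
`σ : (f⁻¹)* 𝔻 ≃ 𝔻` is an isomorphism `⋀ (f V⁺ / M) ≃ ⋀ (V⁺ / M)` of determinant lines. When `M`
is replaced by a smaller `M'`, it changes according to the canonical isomorphisms
`⋀ (A / M) ⊗ ⋀ (M / M') ≃ ⋀ (A / M')`, `π y ⊗ x ↦ y ∧ x`, for `A = V⁺` and `A = f V⁺`. -/
@[ext]
structure DetLift (f : R⸨X⸩ˣ) where
  toEquiv : ∀ M : Submodule K R⸨X⸩, Admissible K f M →
    (DetLine K (mulVplus K f) M ≃ₗ[K] DetLine K (Vplus K R) M)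
  compat : ∀ (M M' : Submodule K R⸨X⸩) (hM : Admissible K f M) (hM' : Admissible K f M')
    (hle : M' ≤ M)
    (u : ⋀[K]^(Module.finrank K (RelQuot K (mulVplus K f) M)) (RelQuot K (mulVplus K f) M'))
    (v : ⋀[K]^(Module.finrank K (RelQuot K (Vplus K R) M)) (RelQuot K (Vplus K R) M'))
    (x : DetLine K M M'),
    toEquiv M hM (exteriorPower.map _ (relProj (mulVplus K f) hle) u) =
        exteriorPower.map _ (relProj (Vplus K R) hle) v →
    ∀ y : DetLine K (mulVplus K f) M',
      (y : ExteriorAlgebra K (RelQuot K (mulVplus K f) M')) =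
        (u : ExteriorAlgebra K (RelQuot K (mulVplus K f) M')) *
          ExteriorAlgebra.map (relIncl M' hM.le_right) (x : ExteriorAlgebra K (RelQuot K M M')) →
      (toEquiv M' hM' y : ExteriorAlgebra K (RelQuot K (Vplus K R) M')) =
        (v : ExteriorAlgebra K (RelQuot K (Vplus K R) M')) *
          ExteriorAlgebra.map (relIncl M' hM.le_left) (x : ExteriorAlgebra K (RelQuot K M M'))

variable {K}

/-- The group law of the central extension: `(ρ, h)` is the product
`(σ, f) (τ, g) = (σ ∘ (f⁻¹)* τ, f g)`. Here `(f⁻¹)* τ` is the isomorphism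
`⋀ (f g V⁺ / f M) ≃ ⋀ (f V⁺ / f M)` obtained from `τ : ⋀ (g V⁺ / M) ≃ ⋀ (V⁺ / M)` by transport
along the homothety `f`. -/
def IsProduct {f g h : R⸨X⸩ˣ} (e : h = f * g)
    (σ : DetLift K f) (τ : DetLift K g) (ρ : DetLift K h) : Prop :=
  ∀ (M M₁ : Submodule K R⸨X⸩) (hM₁ : M.map (homothety K f : R⸨X⸩ →ₗ[K] R⸨X⸩) = M₁)
    (hg : Admissible K g M) (hf : Admissible K f M₁) (hh : Admissible K h M₁)
    (y : DetLine K (mulVplus K g) M),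
    ρ.toEquiv M₁ hh (detTransport (homothety K f) (map_mulVplus K e) hM₁ y) =
      σ.toEquiv M₁ hf (detTransport (homothety K f) rfl hM₁ (τ.toEquiv M hg y))

variable (K)

/-- The unit `c` of `K` is the commutator `⟨f, g⟩` in the central extension by `Kˣ`: the products
`f̃ g̃` and `g̃ f̃` of preimages of `f` and `g` exist and satisfy `f̃ g̃ = c · g̃ f̃`, for all choices
of the preimages. -/
def IsCommutator (f g : R⸨X⸩ˣ) (c : Kˣ) : Prop :=
  Nonempty (DetLift K f) ∧ Nonempty (DetLift K g) ∧
  ∀ (σ : DetLift K f) (τ : DetLift K g),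
    (∃ ρ : DetLift K (f * g), IsProduct rfl σ τ ρ) ∧
    (∃ ρ' : DetLift K (f * g), IsProduct (mul_comm f g) τ σ ρ') ∧
    ∀ ρ ρ' : DetLift K (f * g), IsProduct rfl σ τ ρ → IsProduct (mul_comm f g) τ σ ρ' →
      ∀ (M : Submodule K R⸨X⸩) (hM : Admissible K (f * g) M)
        (y : DetLine K (mulVplus K (f * g)) M),
        ρ.toEquiv M hM y = (c : K) • ρ'.toEquiv M hM y

end Extension

/-! ### Product expansions -/

section Products

variable {R : Type*} [CommRing R]

/-- The `z`-adically convergent infinite product `∏_{i ≥ 0} (1 - a i z ^ i)`; its coefficient of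
`z ^ n` is that of the finite product of the factors with `i ≤ n`. -/
def posProduct (a : ℕ → R) : R⟦X⟧ :=
  PowerSeries.mk fun n => PowerSeries.coeff n
    (∏ i ∈ Finset.range (n + 1), (1 - PowerSeries.C (a i) * PowerSeries.X ^ i : R⟦X⟧))

/-- The series `∏_{i > 0} (1 - ā i z ^ (-i)) ∏_{i ≥ 0} (1 - a i z ^ i)` in `R((z))`. -/
def laurentProduct (abar : ℕ+ →₀ R) (a : ℕ → R) : R⸨X⸩ :=
  (∏ i ∈ abar.support, (1 - HahnSeries.single (-((i : ℕ) : ℤ)) (abar i) : R⸨X⸩)) *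
    HahnSeries.ofPowerSeries ℤ R (posProduct a)

/-- The factor `(1 - a i ^ (j / (i, j)) b̄ j ^ (i / (i, j))) ^ (i, j)`. -/
def symbolFactor (a : ℕ → R) (bbar : ℕ+ →₀ R) (p : ℕ+ × ℕ+) : R :=
  (1 - a p.1 ^ ((p.2 : ℕ) / Nat.gcd p.1 p.2) * bbar p.2 ^ ((p.1 : ℕ) / Nat.gcd p.1 p.2)) ^
    Nat.gcd p.1 p.2

end Products

end ContouCarrere

end

/-!
Write `T_h` for the Toeplitz operator with symbol `h`: multiplication by `h` on `V⁺ = R[[z]]`,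
followed by the projection `R((z)) → V⁺`. The projection is the identity on every `M` contained in
`V⁺` and in `f V⁺`; when `T_f` is invertible it therefore induces isomorphisms `f V⁺ / M ≃ V⁺ / M`
(`relPosPart`), and their maximal exterior powers form a canonical lift of `f`. Every other lift
is a scalar multiple of it (`exists_isScaled`, `exists_scale`): for each `M` two isomorphisms of
lines differ by a unit, and the compatibility for `M' ≤ M` forces these units to agree.

The product of the canonical lifts of `f` and `g` differs from that of `f g` by the Fredholm
determinant of `T_f T_g T_{fg}⁻¹`, an operator which is the identity on a neighbourhood of `0`
(`canonicalIso_product`, `HasDet`). Hence `⟨f, g⟩` is the quotient of two such determinants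
(`isCommutator_of_hasDet`). If `f = q p` and `g = q' p'` with `p, p'` units of `R[[z]]` and `q,
q'` units of `R[z⁻¹]`, then `T_{qp} = T_q T_p`, and up to conjugation `T_f T_g T_{fg}⁻¹` is the
commutator of `T_p` and `T_{q'}`. Its determinant, the symbol of `p` and `q'` (`HasSymbol`), is
multiplicative in `p` and is `1` if `p` is constant or close enough to `1`. So the infinite
product may be replaced by finitely many factors `p = 1 - a z ^ i`.

For such `p`, the commutator differs from `1` by an operator with values in the polynomials of
degree `< i`, and `T_p` maps the space of all `x / (1 - a z ^ i)`, where `deg x < i`, onto these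
polynomials. The operator `T_{z⁻¹}` acts on that space as a cyclic shift weighted by `a`. This
identifies the symbol with the determinant of `q'` evaluated at the cyclic shift
(`hasSymbol_one_sub_single`). The determinant is computed for indeterminate `a` and `b`, where the
cyclic shift can be diagonalised (`det_one_sub_cyclicMatrix_pow`).

All of this takes place over a local ring `K` such that `R` is a finite free `K`-algebra. The norm
from `R` to `K` appears when the determinant of an `R`-linear map is taken over `K`; the two
formulas are the cases `K = R` and `K = k`.
-/

open scoped LaurentSeries PowerSeries

noncomputable section

namespace ContouCarrere

open Module Polynomial

/-! ### Exterior powers of maximal degree -/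

section TopPower

variable {K : Type*} [CommRing K] {N N' : Type*} [AddCommGroup N] [Module K N]
  [AddCommGroup N'] [Module K N']

lemma coe_exteriorPower_map (n : ℕ) (φ : N →ₗ[K] N') (x : ⋀[K]^n N) :
    ((exteriorPower.map n φ x : ⋀[K]^n N') : ExteriorAlgebra K N') =
      ExteriorAlgebra.map φ (x : ExteriorAlgebra K N) := by
  have h : (⋀[K]^n N').subtype ∘ₗ exteriorPower.map n φ =
      (ExteriorAlgebra.map φ).toLinearMap ∘ₗ (⋀[K]^n N).subtype := by
    ext m
    simp
  exact LinearMap.congr_fun h x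

/-- An endomorphism of a finite free module acts on the exterior power of maximal degree through
its determinant. -/
lemma exteriorPower_map_eq_det_smul [Nontrivial K] [Module.Free K N] [Module.Finite K N]
    (φ : N →ₗ[K] N) (x : ⋀[K]^(finrank K N) N) :
    exteriorPower.map (finrank K N) φ x = LinearMap.det φ • x := by
  suffices h : exteriorPower.map (finrank K N) φ = LinearMap.det φ • LinearMap.id by
    rw [h]; simp
  set b := finBasis K N
  apply exteriorPower.linearMap_ext
  refine Basis.ext_alternating b fun i hi => ?_
  let σ : Equiv.Perm (Fin (finrank K N)) :=
    Equiv.ofBijective i (Finite.injective_iff_bijective.1 hi)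
  -- Both sides are alternating in the arguments, so the identity permutation suffices.
  have key : ∀ v : Fin (finrank K N) → N, exteriorPower.ιMulti K (finrank K N) v =
      b.det v • exteriorPower.ιMulti K (finrank K N) b := by
    have h : exteriorPower.ιMulti K (finrank K N) =
        (LinearMap.toSpanSingleton K _
          (exteriorPower.ιMulti K (finrank K N) b)).compAlternatingMap b.det := by
      refine Basis.ext_alternating b fun j hj => ?_
      let τ : Equiv.Perm (Fin (finrank K N)) :=
        Equiv.ofBijective j (Finite.injective_iff_bijective.1 hj)
      change exteriorPower.ιMulti K (finrank K N) (b ∘ τ) =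
        b.det (b ∘ τ) • exteriorPower.ιMulti K (finrank K N) b
      simp [AlternatingMap.map_perm, Basis.det_self]
    intro v
    conv_lhs => rw [h]
    rfl
  change exteriorPower.map _ φ (exteriorPower.ιMulti K _ (b ∘ i)) =
    LinearMap.det φ • exteriorPower.ιMulti K _ (b ∘ i)
  rw [exteriorPower.map_apply_ιMulti, key, key (b ∘ i), Basis.det_comp, mul_smul]

lemma finrank_detPower [Nontrivial K] [Module.Free K N] [Module.Finite K N] :
    finrank K (⋀[K]^(finrank K N) N) = 1 := by
  rw [exteriorPower.finrank_eq, Nat.choose_self]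

/-- Two isomorphisms of modules of rank one differ by a unit. -/
lemma exists_unit_smul_eq [Nontrivial K] {L L' : Type*} [AddCommGroup L] [Module K L]
    [AddCommGroup L'] [Module K L'] [Module.Free K L] (hL : finrank K L = 1)
    (σ τ : L ≃ₗ[K] L') : ∃ c : Kˣ, ∀ y, σ y = (c : K) • τ y := by
  obtain ⟨c, hc, -⟩ := (LinearMap.existsUnique_eq_smul_id_of_finrank_eq_one hL
    (σ.trans τ.symm).toLinearMap)
  obtain ⟨d, hd, -⟩ := (LinearMap.existsUnique_eq_smul_id_of_finrank_eq_one hL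
    (τ.trans σ.symm).toLinearMap)
  have hc' : ∀ y, σ y = c • τ y := fun y => by
    have := congrArg τ (LinearMap.congr_fun hc y)
    simpa using this
  have hd' : ∀ y, τ y = d • σ y := fun y => by
    have := congrArg σ (LinearMap.congr_fun hd y)
    simpa using this
  have hcd : c * d = 1 := by
    have huniq := (LinearMap.existsUnique_eq_smul_id_of_finrank_eq_one hL
      (LinearMap.id : L →ₗ[K] L)).unique (y₁ := c * d) (y₂ := 1) (by
        ext y
        apply σ.injective
        simp only [LinearMap.id_apply, LinearMap.smul_apply, map_smul]
        rw [mul_smul, ← hd', ← hc']) (by simp)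
    exact huniq
  exact ⟨⟨c, d, hcd, by rw [mul_comm, hcd]⟩, hc'⟩

/-- The isomorphism of exterior powers of maximal degree induced by an isomorphism. -/
def topPowerEquiv (φ : N ≃ₗ[K] N') : (⋀[K]^(finrank K N) N) ≃ₗ[K] (⋀[K]^(finrank K N') N') :=
  LinearEquiv.ofLinearMap
    ((LinearEquiv.ofEq (⋀[K]^(finrank K N) N') (⋀[K]^(finrank K N') N')
      (by rw [φ.finrank_eq])).toLinearMap ∘ₗ exteriorPower.map _ φ.toLinearMap)
    ((LinearEquiv.ofEq (⋀[K]^(finrank K N') N) (⋀[K]^(finrank K N) N)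
      (by rw [φ.finrank_eq])).toLinearMap ∘ₗ exteriorPower.map _ φ.symm.toLinearMap)
    (by
      ext1
      ext m
      simp [coe_exteriorPower_map, ExteriorAlgebra.map_apply_ιMulti, Function.comp_def])
    (by
      ext1
      ext m
      simp [coe_exteriorPower_map, ExteriorAlgebra.map_apply_ιMulti, Function.comp_def])

lemma coe_topPowerEquiv (φ : N ≃ₗ[K] N') (x : ⋀[K]^(finrank K N) N) :
    (topPowerEquiv φ x : ExteriorAlgebra K N') =
      ExteriorAlgebra.map φ.toLinearMap (x : ExteriorAlgebra K N) := by
  rw [← coe_exteriorPower_map]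
  rfl

/-- In degree beyond the rank there is nothing: `m ∧ x = 0` for `x` of maximal degree. -/
lemma ι_mul_eq_zero [Nontrivial K] [Module.Free K N] [Module.Finite K N] (m : N)
    (x : ⋀[K]^(finrank K N) N) : ExteriorAlgebra.ι K m * (x : ExteriorAlgebra K N) = 0 := by
  have h0 : finrank K (⋀[K]^(finrank K N + 1) N) = 0 := by
    rw [exteriorPower.finrank_eq, Nat.choose_succ_self]
  have hsub : Subsingleton (⋀[K]^(finrank K N + 1) N) :=
    Module.finrank_eq_zero_iff_of_free K _ |>.1 h0
  have hmem : ExteriorAlgebra.ι K m * (x : ExteriorAlgebra K N) ∈ ⋀[K]^(finrank K N + 1) N := by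
    change _ ∈ (LinearMap.range (ExteriorAlgebra.ι K)) ^ (finrank K N + 1)
    rw [pow_succ']
    exact Submodule.mul_mem_mul (LinearMap.mem_range_self _ m) x.2
  exact congrArg Subtype.val (Subsingleton.elim (⟨_, hmem⟩ : ⋀[K]^(finrank K N + 1) N) 0)

end TopPower

/-! ### Exterior powers and short exact sequences -/

section Exact

variable {K : Type*} [CommRing K] {S T Q : Type*} [AddCommGroup S] [Module K S]
  [AddCommGroup T] [Module K T] [AddCommGroup Q] [Module K Q]
  {i : S →ₗ[K] T} {π : T →ₗ[K] Q}

open ExteriorAlgebra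

/-- If `X` is killed by the image of `S`, then `v ∧ X` only depends on the factors of `v` modulo the
image of `S`. -/
lemma mul_eq_map_mul {θ : T →ₗ[K] T} (hθ : ∀ t, t - θ t ∈ LinearMap.range i)
    (v X : ExteriorAlgebra K T) (hX : ∀ s, ι K (i s) * X = 0) :
    v * X = ExteriorAlgebra.map θ v * X := by
  suffices h : ∀ X : ExteriorAlgebra K T, (∀ s, ι K (i s) * X = 0) →
      v * X = ExteriorAlgebra.map θ v * X ∧ ∀ s, ι K (i s) * (v * X) = 0 from (h X hX).1
  clear hX X
  induction v using ExteriorAlgebra.induction with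
  | algebraMap r =>
    intro X hX
    refine ⟨by rw [AlgHom.commutes], fun s => ?_⟩
    rw [← Algebra.smul_def, mul_smul_comm, hX, smul_zero]
  | ι t =>
    intro X hX
    constructor
    · obtain ⟨s, hs⟩ := hθ t
      rw [map_apply_ι, ← sub_eq_zero, ← sub_mul, ← map_sub, ← hs, hX]
    · intro s
      rw [← mul_assoc, eq_neg_of_add_eq_zero_left (ι_add_mul_swap (i s) t), neg_mul, mul_assoc, hX,
        mul_zero, neg_zero]
  | mul v w hv hw =>
    intro X hX
    obtain ⟨h₁, h₂⟩ := hw X hX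
    obtain ⟨h₃, h₄⟩ := hv _ h₂
    refine ⟨?_, fun s => ?_⟩
    · rw [mul_assoc, h₃, h₁, map_mul, mul_assoc]
    · rw [mul_assoc]; exact h₄ s
  | add v w hv hw =>
    intro X hX
    obtain ⟨h₁, h₂⟩ := hw X hX
    obtain ⟨h₃, h₄⟩ := hv X hX
    refine ⟨?_, fun s => ?_⟩
    · rw [add_mul, h₃, h₁, map_add, add_mul]
    · rw [add_mul, mul_add, h₄, h₂, add_zero]

/-- For `0 → S → T → Q → 0` exact, the product `v ∧ x` with `x` in the exterior power of maximal
degree of `S` depends only on the image of `v` in `⋀ Q`. -/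
lemma mul_map_eq_of_map_eq [Nontrivial K] [Module.Free K S] [Module.Finite K S]
    [Module.Projective K Q] (hπ : Function.Surjective π)
    (hexact : LinearMap.ker π = LinearMap.range i) {v w : ExteriorAlgebra K T}
    (hvw : ExteriorAlgebra.map π v = ExteriorAlgebra.map π w) (x : ⋀[K]^(finrank K S) S) :
    v * ExteriorAlgebra.map i (x : ExteriorAlgebra K S) =
      w * ExteriorAlgebra.map i (x : ExteriorAlgebra K S) := by
  obtain ⟨s, hs⟩ := Module.projective_lifting_property π LinearMap.id hπ
  have hθ : ∀ t, t - (s ∘ₗ π) t ∈ LinearMap.range i := by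
    intro t
    rw [← hexact, LinearMap.mem_ker, map_sub]
    have := LinearMap.congr_fun hs (π t)
    simp only [LinearMap.comp_apply, LinearMap.id_apply] at this ⊢
    rw [this, sub_self]
  have hX : ∀ m, ι K (i m) * ExteriorAlgebra.map i (x : ExteriorAlgebra K S) = 0 := by
    intro m
    rw [← map_apply_ι, ← map_mul, ι_mul_eq_zero, map_zero]
  rw [mul_eq_map_mul hθ v _ hX, mul_eq_map_mul hθ w _ hX, ← map_comp_map, AlgHom.comp_apply,
    AlgHom.comp_apply, hvw]

/-- For `0 → S → T → Q → 0` exact, some `u ∧ x` with `u` lifting a maximal exterior power of `Q` and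
`x` a maximal exterior power of `S` generates the maximal exterior power of `T`. -/
lemma exists_mul_map_generator [Nontrivial K] [Module.Free K S] [Module.Finite K S]
    [Module.Free K Q] [Module.Finite K Q] (hi : Function.Injective i) (hπ : Function.Surjective π)
    (hexact : LinearMap.ker π = LinearMap.range i) :
    ∃ (u : ⋀[K]^(finrank K Q) T) (x : ⋀[K]^(finrank K S) S) (y : ⋀[K]^(finrank K T) T),
      (y : ExteriorAlgebra K T) =
        (u : ExteriorAlgebra K T) * ExteriorAlgebra.map i (x : ExteriorAlgebra K S) ∧
      ∀ c d : K, c • y = d • y → c = d := by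
  obtain ⟨s, hs⟩ := Module.projective_lifting_property π LinearMap.id hπ
  have hs' : ∀ q, π (s q) = q := fun q => LinearMap.congr_fun hs q
  have hπi : ∀ m, π (i m) = 0 := fun m => by
    rw [← LinearMap.mem_ker, hexact]; exact LinearMap.mem_range_self _ m
  let e : (Q × S) ≃ₗ[K] T := LinearEquiv.ofBijective (s.coprod i) (by
    constructor
    · rw [← LinearMap.ker_eq_bot, LinearMap.ker_eq_bot']
      rintro ⟨q, m⟩ h
      simp only [LinearMap.coprod_apply] at h
      have hq : q = 0 := by simpa [hs', hπi] using congrArg π h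
      subst hq
      have hm : m = 0 := hi (by simpa using h)
      rw [hm]; rfl
    · intro t
      have ht : t - s (π t) ∈ LinearMap.range i := by
        rw [← hexact, LinearMap.mem_ker, map_sub, hs', sub_self]
      obtain ⟨m, hm⟩ := ht
      exact ⟨(π t, m), by simp [hm]⟩)
  have he : ∀ q m, e (q, m) = s q + i m := fun _ _ => rfl
  have hrank : finrank K T = finrank K Q + finrank K S := by
    rw [← e.finrank_eq, finrank_prod]
  let bQ := finBasis K Q
  let bS := finBasis K S
  let b : Basis (Fin (finrank K Q + finrank K S)) K T :=
    ((bQ.prod bS).map e).reindex finSumFinEquiv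
  have hb : (b : Fin (finrank K Q + finrank K S) → T) = Fin.append (s ∘ bQ) (i ∘ bS) := by
    funext j
    refine Fin.addCases (fun j => ?_) (fun j => ?_) j
    · simp [b, he]
    · simp [b, he]
  refine ⟨exteriorPower.ιMulti K _ (s ∘ bQ), exteriorPower.ιMulti K _ bS,
    (LinearEquiv.ofEq (⋀[K]^(finrank K Q + finrank K S) T) (⋀[K]^(finrank K T) T)
      (by rw [hrank])) (exteriorPower.ιMulti K _ b), ?_, ?_⟩
  · simp only [LinearEquiv.coe_ofEq_apply, exteriorPower.ιMulti_apply_coe,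
      ExteriorAlgebra.map_apply_ιMulti]
    rw [ExteriorAlgebra.ιMulti_mul_ιMulti, hb]
  · intro c d hcd
    have hcd' : c • exteriorPower.ιMulti K _ b = d • exteriorPower.ιMulti K _ b := by
      apply (LinearEquiv.ofEq (⋀[K]^(finrank K Q + finrank K S) T) (⋀[K]^(finrank K T) T)
        (by rw [hrank])).injective
      rw [LinearEquiv.map_smul, LinearEquiv.map_smul]
      exact hcd
    have h := congrArg (exteriorPower.alternatingMapLinearEquiv b.det) hcd'
    simpa [exteriorPower.alternatingMapLinearEquiv_apply_ιMulti, Basis.det_self] using h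

end Exact

/-! ### Determinants of endomorphisms which are the identity on a submodule -/

section QuotientDeterminant

variable {K : Type*} [CommRing K] {E : Type*} [AddCommGroup E] [Module K E]

/-- Sylvester's identity `det (1 + B A) = det (1 + A B)` for linear maps. -/
lemma det_one_add_comp_comm {M N : Type*} [AddCommGroup M] [Module K M] [Module.Free K M]
    [Module.Finite K M] [AddCommGroup N] [Module K N] [Module.Free K N] [Module.Finite K N]
    (A : M →ₗ[K] N) (B : N →ₗ[K] M) :
    LinearMap.det (1 + B ∘ₗ A) = LinearMap.det (1 + A ∘ₗ B) := by
  classical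
  let b := Module.Free.chooseBasis K M
  let b' := Module.Free.chooseBasis K N
  rw [← LinearMap.det_toMatrix b, ← LinearMap.det_toMatrix b', map_add, map_add,
    LinearMap.toMatrix_comp b b' b, LinearMap.toMatrix_comp b' b b', LinearMap.toMatrix_one,
    LinearMap.toMatrix_one, Matrix.det_one_add_mul_comm]

/-- The determinant on `E / N` of an endomorphism of `E` which is the identity on `N`. -/
def detQuot (X : Module.End K E) (N : Submodule K E) (hX : ∀ n ∈ N, X n = n) : K :=
  LinearMap.det (N.mapQ N X fun n hn => by rw [Submodule.mem_comap, hX n hn]; exact hn)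

/-- If `X - 1` takes its values in the image of `ι : F → E`, with retraction `κ`, then the
determinant of `X` is that of its compression `κ X ι` to `F`. -/
lemma detQuot_eq_det_of_factor {F : Type*} [AddCommGroup F] [Module K F] [Module.Free K F]
    [Module.Finite K F] (X : Module.End K E) (N : Submodule K E) (hX : ∀ n ∈ N, X n = n)
    [Module.Free K (E ⧸ N)] [Module.Finite K (E ⧸ N)] (ι : F →ₗ[K] E) (κ : E →ₗ[K] F)
    (hκι : κ ∘ₗ ι = LinearMap.id) (hC : ∀ v, ι (κ (X v - v)) = X v - v) :
    detQuot X N hX = LinearMap.det (κ ∘ₗ X ∘ₗ ι) := by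
  let c : (E ⧸ N) →ₗ[K] F := N.liftQ (κ ∘ₗ (X - 1)) fun n hn => by
    simp [hX n hn]
  have h₁ : N.mapQ N X (fun n hn => by rw [Submodule.mem_comap, hX n hn]; exact hn) =
      1 + (N.mkQ ∘ₗ ι) ∘ₗ c := by
    apply Submodule.linearMap_qext
    ext v
    change N.mkQ (X v) = N.mkQ v + N.mkQ (ι (κ (X v - v)))
    rw [hC, ← map_add, add_sub_cancel]
  have h₂ : κ ∘ₗ X ∘ₗ ι = 1 + c ∘ₗ (N.mkQ ∘ₗ ι) := by
    ext v
    change κ (X (ι v)) = v + κ (X (ι v) - ι v)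
    rw [map_sub, show κ (ι v) = v from LinearMap.congr_fun hκι v, add_sub_cancel]
  rw [detQuot, h₁, h₂, det_one_add_comp_comm]

/-- The determinant on `E / N` does not change when `N` is replaced by a smaller submodule. -/
lemma detQuot_eq_of_le {X : Module.End K E} {N N' : Submodule K E} (hN : N' ≤ N)
    (hX : ∀ n ∈ N, X n = n) [Module.Free K (E ⧸ N)] [Module.Finite K (E ⧸ N)]
    [Module.Free K (E ⧸ N')] [Module.Finite K (E ⧸ N')] :
    detQuot X N' (fun n hn => hX n (hN hn)) = detQuot X N hX := by
  let π : (E ⧸ N') →ₗ[K] (E ⧸ N) := N'.mapQ N LinearMap.id hN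
  have hπ : Function.Surjective π := by
    intro q
    obtain ⟨v, rfl⟩ := N.mkQ_surjective q
    exact ⟨N'.mkQ v, rfl⟩
  obtain ⟨s, hs⟩ := Module.projective_lifting_property π LinearMap.id hπ
  -- `X - 1` factors through `E / N`, so Sylvester's identity moves the determinant there.
  let C : (E ⧸ N) →ₗ[K] (E ⧸ N') := N.liftQ (N'.mkQ ∘ₗ (X - 1)) fun n hn => by simp [hX n hn]
  have h₁ : N'.mapQ N' X (fun n hn => by
      rw [Submodule.mem_comap, hX n (hN hn)]; exact hn) = 1 + C ∘ₗ π := by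
    apply Submodule.linearMap_qext
    ext v
    change N'.mkQ (X v) = N'.mkQ v + N'.mkQ (X v - v)
    rw [← map_add, add_sub_cancel]
  have h₂ : N.mapQ N X (fun n hn => by rw [Submodule.mem_comap, hX n hn]; exact hn) =
      1 + π ∘ₗ C := by
    apply Submodule.linearMap_qext
    ext v
    change N.mkQ (X v) = N.mkQ v + N.mkQ (X v - v)
    rw [← map_add, add_sub_cancel]
  rw [detQuot, detQuot, h₁, h₂, det_one_add_comp_comm]

lemma detQuot_mul {X Y : Module.End K E} {N : Submodule K E} (hX : ∀ n ∈ N, X n = n)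
    (hY : ∀ n ∈ N, Y n = n) :
    detQuot (X * Y) N (fun n hn => by rw [Module.End.mul_apply, hY n hn, hX n hn]) =
      detQuot X N hX * detQuot Y N hY := by
  rw [detQuot, detQuot, detQuot, ← map_mul]
  congr 1
  apply Submodule.linearMap_qext
  rfl

lemma fixes_conj {X : Module.End K E} {N : Submodule K E} (hX : ∀ n ∈ N, X n = n)
    (B : (Module.End K E)ˣ) :
    ∀ n ∈ N.map (B : Module.End K E),
      ((B : Module.End K E) * X * (↑B⁻¹ : Module.End K E)) n = n := by
  rintro _ ⟨n, hn, rfl⟩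
  have : (↑B⁻¹ : Module.End K E) ((B : Module.End K E) n) = n := by
    rw [← Module.End.mul_apply, Units.inv_mul, Module.End.one_apply]
  change (B : Module.End K E) (X ((↑B⁻¹ : Module.End K E) ((B : Module.End K E) n))) = _
  rw [this, hX n hn]

/-- The isomorphism `E / N ≃ E / B N` induced by an automorphism `B`. -/
def quotMapEquiv (B : (Module.End K E)ˣ) (N : Submodule K E) :
    (E ⧸ N) ≃ₗ[K] (E ⧸ N.map (B : Module.End K E)) :=
  Submodule.Quotient.equiv N (N.map (B : Module.End K E))
    (LinearMap.GeneralLinearGroup.toLinearEquiv B) rfl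

lemma detQuot_conj {X : Module.End K E} {N : Submodule K E} (hX : ∀ n ∈ N, X n = n)
    (B : (Module.End K E)ˣ) :
    detQuot ((B : Module.End K E) * X * (↑B⁻¹ : Module.End K E)) (N.map (B : Module.End K E))
      (fixes_conj hX B) = detQuot X N hX := by
  rw [detQuot, detQuot, ← LinearMap.det_conj _ (quotMapEquiv B N)]
  congr 1
  apply Submodule.linearMap_qext
  rfl

end QuotientDeterminant

/-! ### Laurent series, Toeplitz operators -/

section Laurent

variable {R : Type*} [CommRing R]

lemma lattice_anti (K : Type*) [CommRing K] [Algebra K R] {M N : ℤ} (h : M ≤ N) :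
    lattice K R N ≤ lattice K R M := fun _ hv n hn => hv n (hn.trans_le h)

lemma exists_mem_lattice (K : Type*) [CommRing K] [Algebra K R] (v : R⸨X⸩) :
    ∃ D : ℕ, v ∈ lattice K R (-(D : ℤ)) := by
  refine ⟨(-v.order).toNat, fun n hn => HahnSeries.coeff_eq_zero_of_lt_order ?_⟩
  omega

lemma mul_mem_lattice (K : Type*) [CommRing K] [Algebra K R] {M N : ℤ} {x y : R⸨X⸩}
    (hx : x ∈ lattice K R M) (hy : y ∈ lattice K R N) : x * y ∈ lattice K R (M + N) := by
  intro n hn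
  rw [HahnSeries.coeff_mul]
  refine Finset.sum_eq_zero fun ij hij => ?_
  have h := (Finset.mem_antidiagonal.1 hij).2.2
  by_cases h₁ : ij.1 < M
  · rw [hx _ h₁, zero_mul]
  · rw [hy ij.2 (by omega), mul_zero]

lemma ofPowerSeries_mem (K : Type*) [CommRing K] [Algebra K R] (p : R⟦X⟧) :
    HahnSeries.ofPowerSeries ℤ R p ∈ Vplus K R := by
  intro n hn
  rw [PowerSeries.coeff_coe, if_pos hn]

variable (R) in
/-- The series in `R((z))` without terms of positive degree: the ring `R[z⁻¹]`. -/
def negSubring : Subring R⸨X⸩ where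
  carrier := {v | ∀ n : ℤ, 0 < n → v.coeff n = 0}
  mul_mem' := by
    intro x y hx hy n hn
    rw [HahnSeries.coeff_mul]
    refine Finset.sum_eq_zero fun ij hij => ?_
    have h := (Finset.mem_antidiagonal.1 hij).2.2
    by_cases h₁ : 0 < ij.1
    · rw [hx _ h₁, zero_mul]
    · rw [hy ij.2 (by omega), mul_zero]
  one_mem' := by
    intro n hn
    rw [HahnSeries.coeff_one, if_neg hn.ne']
  add_mem' := by
    intro x y hx hy n hn
    rw [HahnSeries.coeff_add, hx n hn, hy n hn, add_zero]
  zero_mem' := by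
    intro n _
    rfl
  neg_mem' := by
    intro x hx n hn
    rw [HahnSeries.coeff_neg, hx n hn, neg_zero]

/-- `R[z⁻¹]` preserves `z⁻¹ R[z⁻¹]`. -/
lemma coeff_mul_eq_zero_of_negative {x u : R⸨X⸩} (hx : x ∈ negSubring R)
    (hu : ∀ n : ℤ, 0 ≤ n → u.coeff n = 0) : ∀ n : ℤ, 0 ≤ n → (x * u).coeff n = 0 := by
  intro n hn
  rw [HahnSeries.coeff_mul]
  refine Finset.sum_eq_zero fun ij hij => ?_
  have h := (Finset.mem_antidiagonal.1 hij).2.2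
  by_cases h₁ : 0 < ij.1
  · rw [hx _ h₁, zero_mul]
  · rw [hu ij.2 (by omega), mul_zero]

lemma single_mem_negSubring {m : ℤ} (hm : m ≤ 0) (c : R) :
    (HahnSeries.single m c : R⸨X⸩) ∈ negSubring R := by
  intro n hn
  exact HahnSeries.coeff_single_of_ne (by omega)

variable (R) in
/-- The units of `R[z⁻¹]`. -/
def negUnits : Subgroup R⸨X⸩ˣ where
  carrier := {q | (q : R⸨X⸩) ∈ negSubring R ∧ (↑q⁻¹ : R⸨X⸩) ∈ negSubring R}
  mul_mem' := by
    rintro x y ⟨hx, hx'⟩ ⟨hy, hy'⟩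
    refine ⟨by rw [Units.val_mul]; exact mul_mem hx hy, ?_⟩
    rw [mul_inv, Units.val_mul]
    exact mul_mem hx' hy'
  one_mem' := ⟨by simp [one_mem], by simp [one_mem]⟩
  inv_mem' := by
    rintro x ⟨hx, hx'⟩
    exact ⟨hx', by rwa [inv_inv]⟩

variable (R) in
/-- The units of `R[[z]]`. -/
def posUnits : Subgroup R⸨X⸩ˣ where
  carrier := {p | (p : R⸨X⸩) ∈ Vplus R R ∧ (↑p⁻¹ : R⸨X⸩) ∈ Vplus R R}
  mul_mem' := by
    rintro x y ⟨hx, hx'⟩ ⟨hy, hy'⟩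
    refine ⟨by rw [Units.val_mul]; exact mul_mem_lattice R hx hy, ?_⟩
    rw [mul_inv, Units.val_mul]
    exact mul_mem_lattice R hx' hy'
  one_mem' := by
    have h : (1 : R⸨X⸩) ∈ Vplus R R := by
      intro n hn
      rw [HahnSeries.coeff_one, if_neg hn.ne]
    exact ⟨by simpa using h, by simpa using h⟩
  inv_mem' := by
    rintro x ⟨hx, hx'⟩
    exact ⟨hx', by rwa [inv_inv]⟩

end Laurent

section Toeplitz

variable (K : Type*) [CommRing K] {R : Type*} [CommRing R] [Algebra K R]

/-- The projection of `R((z))` onto `R[[z]]` that forgets the terms of negative degree. -/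
def posPart : R⸨X⸩ →ₗ[K] Vplus K R :=
  LinearMap.codRestrict (Vplus K R) (LinearMap.id - HahnSeries.truncLTLinearMap K (0 : ℤ)) (by
    intro v n hn
    simp [HahnSeries.coeff_truncLT_of_lt hn])

lemma coeff_posPart (v : R⸨X⸩) {n : ℤ} (hn : 0 ≤ n) :
    (posPart K v : R⸨X⸩).coeff n = v.coeff n := by
  change (v - HahnSeries.truncLT 0 v).coeff n = v.coeff n
  rw [HahnSeries.coeff_sub, HahnSeries.coeff_truncLT_of_le hn, sub_zero]

lemma posPart_of_mem {v : R⸨X⸩} (hv : v ∈ Vplus K R) : (posPart K v : R⸨X⸩) = v := by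
  ext n
  by_cases hn : n < 0
  · rw [hv n hn, (posPart K v).2 n hn]
  · exact coeff_posPart K v (not_lt.1 hn)

@[simp]
lemma posPart_coe (v : Vplus K R) : posPart K (v : R⸨X⸩) = v := Subtype.ext (posPart_of_mem K v.2)

lemma posPart_congr {v w : R⸨X⸩} (h : ∀ n : ℤ, 0 ≤ n → (v - w).coeff n = 0) :
    posPart K v = posPart K w := by
  ext n
  by_cases hn : n < 0
  · rw [(posPart K v).2 n hn, (posPart K w).2 n hn]
  · have := h n (not_lt.1 hn)
    rw [HahnSeries.coeff_sub, sub_eq_zero] at this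
    rw [coeff_posPart K v (not_lt.1 hn), coeff_posPart K w (not_lt.1 hn), this]

lemma posPart_mem_lattice {N : ℤ} {v : R⸨X⸩} (hv : v ∈ lattice K R N) :
    (posPart K v : R⸨X⸩) ∈ lattice K R N := by
  intro n hn
  by_cases h : n < 0
  · exact (posPart K v).2 n h
  · rw [coeff_posPart K v (not_lt.1 h), hv n hn]

lemma smul_eq_C_mul (c : K) (v : R⸨X⸩) :
    c • v = (HahnSeries.C (algebraMap K R c) : R⸨X⸩) * v := by
  ext n
  simp [Algebra.smul_def]

/-- Multiplication by `h`, as a `K`-linear endomorphism of `R((z))`. -/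
def mulBy (h : R⸨X⸩) : Module.End K R⸨X⸩ where
  toFun v := h * v
  map_add' u v := mul_add h u v
  map_smul' c v := by
    simp only [smul_eq_C_mul, RingHom.id_apply]
    ring

/-- The Toeplitz operator with symbol `h`: multiplication by `h`, followed by the projection onto
`R[[z]]`. -/
def toeplitz (h : R⸨X⸩) : Module.End K (Vplus K R) :=
  posPart K ∘ₗ mulBy K h ∘ₗ (Vplus K R).subtype

lemma toeplitz_apply (h : R⸨X⸩) (v : Vplus K R) : toeplitz K h v = posPart K (h * (v : R⸨X⸩)) := rfl

lemma toeplitz_one : toeplitz K (1 : R⸨X⸩) = 1 := by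
  ext1 v
  rw [toeplitz_apply, one_mul, posPart_coe, Module.End.one_apply]

lemma toeplitz_add (h h' : R⸨X⸩) : toeplitz K (h + h') = toeplitz K h + toeplitz K h' := by
  ext1 v
  simp only [toeplitz_apply, add_mul, map_add, LinearMap.add_apply]

lemma toeplitz_mul_of_positive (h : R⸨X⸩) {p : R⸨X⸩} (hp : p ∈ Vplus R R) :
    toeplitz K (h * p) = toeplitz K h * toeplitz K p := by
  ext1 v
  have hv : p * (v : R⸨X⸩) ∈ Vplus K R := by
    have := mul_mem_lattice R hp (show (v : R⸨X⸩) ∈ lattice R R 0 from v.2)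
    exact this
  rw [Module.End.mul_apply, toeplitz_apply, toeplitz_apply, toeplitz_apply, posPart_of_mem K hv,
    mul_assoc]

lemma toeplitz_mul_of_negative {q : R⸨X⸩} (hq : q ∈ negSubring R) (h : R⸨X⸩) :
    toeplitz K (q * h) = toeplitz K q * toeplitz K h := by
  ext1 v
  rw [Module.End.mul_apply, toeplitz_apply, toeplitz_apply, toeplitz_apply, mul_assoc]
  apply posPart_congr
  rw [← mul_sub]
  apply coeff_mul_eq_zero_of_negative hq
  intro n hn
  rw [HahnSeries.coeff_sub, coeff_posPart K _ hn, sub_self]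

/-- The Toeplitz operators with symbol in the units of `R[[z]]`. -/
def posToeplitz : posUnits R →* (Module.End K (Vplus K R))ˣ where
  toFun p :=
    { val := toeplitz K (p : R⸨X⸩ˣ)
      inv := toeplitz K (↑(p : R⸨X⸩ˣ)⁻¹ : R⸨X⸩)
      val_inv := by rw [← toeplitz_mul_of_positive K _ p.2.2, Units.mul_inv, toeplitz_one]
      inv_val := by rw [← toeplitz_mul_of_positive K _ p.2.1, Units.inv_mul, toeplitz_one] }
  map_one' := Units.ext (toeplitz_one K)
  map_mul' p p' := Units.ext (toeplitz_mul_of_positive K _ p'.2.1)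

/-- The Toeplitz operators with symbol in the units of `R[z⁻¹]`. -/
def negToeplitz : negUnits R →* (Module.End K (Vplus K R))ˣ where
  toFun q :=
    { val := toeplitz K (q : R⸨X⸩ˣ)
      inv := toeplitz K (↑(q : R⸨X⸩ˣ)⁻¹ : R⸨X⸩)
      val_inv := by rw [← toeplitz_mul_of_negative K q.2.1, Units.mul_inv, toeplitz_one]
      inv_val := by rw [← toeplitz_mul_of_negative K q.2.2, Units.inv_mul, toeplitz_one] }
  map_one' := Units.ext (toeplitz_one K)
  map_mul' q q' := Units.ext (toeplitz_mul_of_negative K q.2.1 _)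

lemma coe_posToeplitz (p : posUnits R) :
    (posToeplitz K p : Module.End K (Vplus K R)) = toeplitz K (p : R⸨X⸩ˣ) := rfl

lemma coe_negToeplitz (q : negUnits R) :
    (negToeplitz K q : Module.End K (Vplus K R)) = toeplitz K (q : R⸨X⸩ˣ) := rfl

/-- The Toeplitz operator with symbol `q p` is `T_q T_p`. -/
lemma toeplitz_factor (q : negUnits R) (p : posUnits R) :
    toeplitz K ((q : R⸨X⸩ˣ) * (p : R⸨X⸩ˣ) : R⸨X⸩) =
      (↑(negToeplitz K q * posToeplitz K p) : Module.End K (Vplus K R)) :=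
  toeplitz_mul_of_negative K q.2.1 _

lemma toeplitz_mem_lattice {h : R⸨X⸩} {D N : ℤ} (hh : h ∈ lattice K R D) {v : Vplus K R}
    (hv : (v : R⸨X⸩) ∈ lattice K R N) : (toeplitz K h v : R⸨X⸩) ∈ lattice K R (D + N) :=
  posPart_mem_lattice K (mul_mem_lattice K hh hv)

/-! ### Fredholm determinants on `R[[z]]` -/

variable (R) in
/-- The submodule `z ^ N R[[z]]` of `R[[z]]`. -/
def posLattice (N : ℕ) : Submodule K (Vplus K R) := (lattice K R N).submoduleOf (Vplus K R)

lemma mem_posLattice {N : ℕ} {v : Vplus K R} :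
    v ∈ posLattice K R N ↔ (v : R⸨X⸩) ∈ lattice K R N := Iff.rfl

lemma posLattice_anti {M N : ℕ} (h : M ≤ N) : posLattice K R N ≤ posLattice K R M :=
  fun _ hv => lattice_anti K (by exact_mod_cast h) hv

/-- The truncation `v ↦ (v₀, …, v_{N-1})`. -/
def truncate (N : ℕ) : Vplus K R →ₗ[K] (Fin N → R) where
  toFun v r := (v : R⸨X⸩).coeff (r : ℕ)
  map_add' u v := by ext; simp
  map_smul' c v := by ext; simp

lemma ofPowerSeries_mk_coeff (u : ℕ → R) (n : ℕ) :
    (HahnSeries.ofPowerSeries ℤ R (PowerSeries.mk u)).coeff (n : ℤ) = u n := by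
  rw [HahnSeries.ofPowerSeries_apply_coeff, PowerSeries.coeff_mk]

lemma ker_truncate (N : ℕ) : LinearMap.ker (truncate K N) = posLattice K R N := by
  ext v
  rw [LinearMap.mem_ker, mem_posLattice]
  constructor
  · intro h n hn
    by_cases h0 : n < 0
    · exact v.2 n h0
    · lift n to ℕ using not_lt.1 h0
      exact congrFun h ⟨n, by exact_mod_cast hn⟩
  · intro h
    ext r
    exact h _ (by exact_mod_cast r.2)

lemma truncate_surjective (N : ℕ) : Function.Surjective (truncate K N (R := R)) := by
  intro x
  refine ⟨⟨_, ofPowerSeries_mem K (PowerSeries.mk fun n => if h : n < N then x ⟨n, h⟩ else 0)⟩, ?_⟩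
  ext r
  refine (ofPowerSeries_mk_coeff _ _).trans ?_
  rw [dif_pos r.2]

/-- `R[[z]] / z ^ N R[[z]] ≃ R ^ N`. -/
def posLatticeQuotEquiv (N : ℕ) : (Vplus K R ⧸ posLattice K R N) ≃ₗ[K] (Fin N → R) :=
  (Submodule.quotEquivOfEq _ _ (ker_truncate K N).symm).trans
    ((truncate K N).quotKerEquivOfSurjective (truncate_surjective K N))

instance [Module.Free K R] (N : ℕ) : Module.Free K (Vplus K R ⧸ posLattice K R N) :=
  Module.Free.of_equiv (posLatticeQuotEquiv K N).symm

instance [Module.Finite K R] (N : ℕ) : Module.Finite K (Vplus K R ⧸ posLattice K R N) :=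
  Module.Finite.equiv (posLatticeQuotEquiv K N).symm

lemma finite_quot [Module.Finite K R] {N : ℕ} {M : Submodule K (Vplus K R)}
    (h : posLattice K R N ≤ M) : Module.Finite K (Vplus K R ⧸ M) := by
  exact Module.Finite.of_surjective ((posLattice K R N).mapQ M LinearMap.id h) (by
    intro q
    obtain ⟨v, rfl⟩ := M.mkQ_surjective q
    exact ⟨(posLattice K R N).mkQ v, rfl⟩)

end Toeplitz

section HasDet

variable (K : Type*) [CommRing K] {R : Type*} [CommRing R] [Algebra K R]

/-- A linear endomorphism of `R[[z]]` which is continuous for the `z`-adic topology. -/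
def IsContinuousEnd (T : Module.End K (Vplus K R)) : Prop :=
  ∀ N : ℕ, ∃ N' : ℕ, posLattice K R N' ≤ (posLattice K R N).comap T

lemma toeplitz_isContinuousEnd (h : R⸨X⸩) : IsContinuousEnd K (toeplitz K h) := by
  intro N
  obtain ⟨D, hD⟩ := exists_mem_lattice K h
  refine ⟨N + D, fun v hv => ?_⟩
  have := toeplitz_mem_lattice K hD hv
  rwa [show (-(D : ℤ) + ((N + D : ℕ) : ℤ)) = N by push_cast; ring] at this

variable {K} in
lemma IsContinuousEnd.mul {S T : Module.End K (Vplus K R)} (hS : IsContinuousEnd K S)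
    (hT : IsContinuousEnd K T) : IsContinuousEnd K (S * T) := by
  intro N
  obtain ⟨N', hN'⟩ := hS N
  obtain ⟨N'', hN''⟩ := hT N'
  exact ⟨N'', fun v hv => hN' (hN'' hv)⟩

lemma posToeplitz_inv_isContinuousEnd (p : posUnits R) :
    IsContinuousEnd K (↑(posToeplitz K p)⁻¹ : Module.End K (Vplus K R)) :=
  toeplitz_isContinuousEnd K _

lemma negToeplitz_inv_isContinuousEnd (q : negUnits R) :
    IsContinuousEnd K (↑(negToeplitz K q)⁻¹ : Module.End K (Vplus K R)) :=
  toeplitz_isContinuousEnd K _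

/-- The commutator of Toeplitz operators comes from the polar part of `q w`. -/
lemma toeplitz_commutator_apply (p : posUnits R) (q : R⸨X⸩) (w : Vplus K R) :
    toeplitz K (p.1 : R⸨X⸩) (toeplitz K q w) =
      toeplitz K (q * (p.1 : R⸨X⸩)) w -
        posPart K (((p.1 : R⸨X⸩) - 1) * (q * (w : R⸨X⸩) - (toeplitz K q w : R⸨X⸩))) := by
  have h₁ : posPart K (q * (w : R⸨X⸩) - (toeplitz K q w : R⸨X⸩)) = 0 := by
    rw [map_sub, posPart_coe, toeplitz_apply, sub_self]
  rw [sub_mul, one_mul, map_sub, h₁, sub_zero, toeplitz_apply, toeplitz_apply K (q * _), ← map_sub]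
  congr 1
  ring

variable {K}

/-- The endomorphism `X` of `R[[z]]` is the identity on some `z ^ N R[[z]]`, and `c` is its
determinant on the quotient. -/
def HasDet (X : Module.End K (Vplus K R)) (c : K) : Prop :=
  ∃ (N : ℕ) (hX : ∀ v ∈ posLattice K R N, X v = v), detQuot X (posLattice K R N) hX = c

lemma hasDet_one : HasDet (1 : Module.End K (Vplus K R)) 1 := by
  refine ⟨0, fun v _ => rfl, ?_⟩
  rw [detQuot, ← LinearMap.det_id (A := K) (M := Vplus K R ⧸ posLattice K R 0)]
  congr 1
  apply Submodule.linearMap_qext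
  rfl

/-! ### The symbol of a unit of `R[[z]]` and a unit of `R[z⁻¹]` -/

/-- The Fredholm determinant of the commutator `T_p T_q T_p⁻¹ T_q⁻¹` of Toeplitz operators, for
units `p` of `R[[z]]` and `q` of `R[z⁻¹]`, is `c`. -/
def HasSymbol (p : posUnits R) (q : negUnits R) (c : K) : Prop :=
  HasDet (↑(posToeplitz K p * negToeplitz K q * (posToeplitz K p)⁻¹ * (negToeplitz K q)⁻¹) :
    Module.End K (Vplus K R)) c

lemma hasSymbol_one (q : negUnits R) : HasSymbol (K := K) 1 q 1 := by
  rw [HasSymbol, map_one, one_mul, inv_one, mul_one, mul_inv_cancel]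
  exact hasDet_one

/-- Constants have trivial symbol: their Toeplitz operators commute with those of `R[z⁻¹]`. -/
lemma hasSymbol_of_mem_negSubring {p : posUnits R} (hp : ((p : R⸨X⸩ˣ) : R⸨X⸩) ∈ negSubring R)
    (q : negUnits R) : HasSymbol (K := K) p q 1 := by
  have key : posToeplitz K p * negToeplitz K q * (posToeplitz K p)⁻¹ * (negToeplitz K q)⁻¹ =
      1 := by
    rw [mul_inv_eq_one, mul_inv_eq_iff_eq_mul]
    ext1
    rw [Units.val_mul, Units.val_mul, coe_posToeplitz, coe_negToeplitz,
      ← toeplitz_mul_of_negative K hp, ← toeplitz_mul_of_negative K q.2.1, mul_comm]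
  rw [HasSymbol, key]
  exact hasDet_one

/-- Units of `R[[z]]` sufficiently close to `1`, in terms of `q`, have trivial symbol with `q`. -/
lemma exists_hasSymbol_one_of_congr (q : negUnits R) : ∃ n₀ : ℕ, ∀ n : ℕ, n₀ ≤ n →
    ∀ p : posUnits R, ((p : R⸨X⸩ˣ) : R⸨X⸩) - 1 ∈ lattice R R n → HasSymbol (K := K) p q 1 := by
  obtain ⟨D, hD⟩ := exists_mem_lattice K ((q : R⸨X⸩ˣ) : R⸨X⸩)
  obtain ⟨D', hD'⟩ := exists_mem_lattice K (↑(q : R⸨X⸩ˣ)⁻¹ : R⸨X⸩)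
  -- `T_p T_q T_p⁻¹ T_q⁻¹` is the identity on `z ^ (D + D') R[[z]]` for all `p`, and the identity
  -- modulo `z ^ (n - D) R[[z]]` for `p` congruent to `1` modulo `z ^ n`.
  refine ⟨D + D' + D, fun n hn p hp => ?_⟩
  let X : Module.End K (Vplus K R) :=
    ↑(posToeplitz K p * negToeplitz K q * (posToeplitz K p)⁻¹ * (negToeplitz K q)⁻¹)
  have hw : ∀ v : Vplus K R, ∃ w : Vplus K R,
      w = (↑(posToeplitz K p)⁻¹ : Module.End K (Vplus K R))
        ((↑(negToeplitz K q)⁻¹ : Module.End K (Vplus K R)) v) ∧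
      X v = v - posPart K (((p.1 : R⸨X⸩) - 1) *
        ((q.1 : R⸨X⸩) * (w : R⸨X⸩) - (toeplitz K (q.1 : R⸨X⸩) w : R⸨X⸩))) := by
    intro v
    refine ⟨_, rfl, ?_⟩
    set w := (↑(posToeplitz K p)⁻¹ : Module.End K (Vplus K R))
        ((↑(negToeplitz K q)⁻¹ : Module.End K (Vplus K R)) v) with hw
    have hv : toeplitz K ((q.1 : R⸨X⸩) * (p.1 : R⸨X⸩)) w = v := by
      rw [toeplitz_factor, hw, ← Module.End.mul_apply, ← Module.End.mul_apply, ← Units.val_mul,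
        ← Units.val_mul]
      simp
    rw [← hv, ← toeplitz_commutator_apply, hv]
    rfl
  have hX : ∀ v ∈ posLattice K R (D + D'), X v = v := by
    intro v hv
    obtain ⟨w, hw, hXv⟩ := hw v
    have hwm : (w : R⸨X⸩) ∈ lattice K R (D : ℤ) := by
      rw [hw]
      have := toeplitz_mem_lattice K (show (↑(p : R⸨X⸩ˣ)⁻¹ : R⸨X⸩) ∈ lattice K R 0 from p.2.2)
        (toeplitz_mem_lattice K hD' hv)
      rwa [show (0 : ℤ) + (-(D' : ℤ) + ((D + D' : ℕ) : ℤ)) = D by push_cast; ring] at this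
    have hqw : ((q : R⸨X⸩ˣ) : R⸨X⸩) * (w : R⸨X⸩) ∈ Vplus K R := by
      have := mul_mem_lattice K hD hwm
      rwa [neg_add_cancel] at this
    rw [hXv, toeplitz_apply, posPart_of_mem K hqw, sub_self, mul_zero, map_zero, sub_zero]
  refine ⟨D + D', hX, ?_⟩
  rw [detQuot, ← LinearMap.det_id (A := K) (M := Vplus K R ⧸ posLattice K R (D + D'))]
  congr 1
  apply Submodule.linearMap_qext
  ext1 v
  change (posLattice K R (D + D')).mkQ (X v) = (posLattice K R (D + D')).mkQ v
  rw [← sub_eq_zero, ← map_sub, Submodule.mkQ_apply, Submodule.Quotient.mk_eq_zero, mem_posLattice]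
  obtain ⟨w, -, hXv⟩ := hw v
  rw [hXv, sub_sub_cancel_left, Submodule.coe_neg, Submodule.neg_mem_iff]
  have hqw : (q.1 : R⸨X⸩) * (w : R⸨X⸩) - (toeplitz K (q.1 : R⸨X⸩) w : R⸨X⸩) ∈
      lattice K R (-(D : ℤ)) := by
    have h := mul_mem_lattice K hD (show (w : R⸨X⸩) ∈ lattice K R 0 from w.2)
    rw [add_zero] at h
    exact sub_mem h (posPart_mem_lattice K h)
  refine lattice_anti K ?_ (posPart_mem_lattice K (mul_mem_lattice K hp hqw))
  push_cast
  omega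

variable [Module.Free K R] [Module.Finite K R]

/-- The determinant may be computed on the quotient by any neighbourhood of `0` which is fixed
pointwise. -/
lemma HasDet.detQuot_eq {X : Module.End K (Vplus K R)} {c : K} (h : HasDet X c)
    {M : Submodule K (Vplus K R)} [Module.Free K (Vplus K R ⧸ M)]
    (hM : ∃ N : ℕ, posLattice K R N ≤ M) (hX : ∀ v ∈ M, X v = v) : detQuot X M hX = c := by
  obtain ⟨N, hN⟩ := hM
  obtain ⟨N', hX', rfl⟩ := h
  have := finite_quot K hN
  have hle : posLattice K R (max N N') ≤ posLattice K R N := posLattice_anti K (le_max_left N N')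
  have hle' : posLattice K R (max N N') ≤ posLattice K R N' :=
    posLattice_anti K (le_max_right N N')
  have h₁ := detQuot_eq_of_le (hle.trans hN) hX
  have h₂ := detQuot_eq_of_le hle' hX'
  exact h₁.symm.trans h₂

lemma hasDet_detQuot {X : Module.End K (Vplus K R)}
    {M : Submodule K (Vplus K R)} [Module.Free K (Vplus K R ⧸ M)]
    (hM : ∃ N : ℕ, posLattice K R N ≤ M) (hX : ∀ v ∈ M, X v = v) : HasDet X (detQuot X M hX) := by
  obtain ⟨N, hN⟩ := hM
  have := finite_quot K hN
  exact ⟨N, fun v hv => hX v (hN hv), detQuot_eq_of_le hN hX⟩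

lemma HasDet.mul {X Y : Module.End K (Vplus K R)} {c d : K} (hX : HasDet X c) (hY : HasDet Y d) :
    HasDet (X * Y) (c * d) := by
  obtain ⟨N, hN, -⟩ := id hX
  obtain ⟨N', hN', -⟩ := id hY
  have h₁ : ∀ v ∈ posLattice K R (max N N'), X v = v := fun v hv =>
    hN v (posLattice_anti K (le_max_left N N') hv)
  have h₂ : ∀ v ∈ posLattice K R (max N N'), Y v = v := fun v hv =>
    hN' v (posLattice_anti K (le_max_right N N') hv)
  refine ⟨max N N', fun v hv => by rw [Module.End.mul_apply, h₂ v hv, h₁ v hv], ?_⟩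
  rw [detQuot_mul h₁ h₂, hX.detQuot_eq ⟨_, le_rfl⟩, hY.detQuot_eq ⟨_, le_rfl⟩]

lemma HasDet.conj {X : Module.End K (Vplus K R)} {c : K} (hX : HasDet X c)
    (B : (Module.End K (Vplus K R))ˣ)
    (hB : IsContinuousEnd K (↑B⁻¹ : Module.End K (Vplus K R))) :
    HasDet ((B : Module.End K (Vplus K R)) * X * (↑B⁻¹ : Module.End K (Vplus K R))) c := by
  obtain ⟨N, hN, rfl⟩ := hX
  rw [← detQuot_conj hN B]
  have : Module.Free K (Vplus K R ⧸ (posLattice K R N).map (B : Module.End K (Vplus K R))) :=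
    Module.Free.of_equiv (quotMapEquiv B (posLattice K R N))
  apply hasDet_detQuot
  obtain ⟨N', hN'⟩ := hB N
  refine ⟨N', fun v hv => ⟨(↑B⁻¹ : Module.End K (Vplus K R)) v, hN' hv, ?_⟩⟩
  rw [← Module.End.mul_apply, Units.mul_inv, Module.End.one_apply]

lemma HasSymbol.mul {p p' : posUnits R} {q : negUnits R} {c c' : K} (h : HasSymbol p q c)
    (h' : HasSymbol p' q c') : HasSymbol (p * p') q (c * c') := by
  have key : posToeplitz K (p * p') * negToeplitz K q * (posToeplitz K (p * p'))⁻¹ *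
        (negToeplitz K q)⁻¹ =
      (posToeplitz K p * (posToeplitz K p' * negToeplitz K q * (posToeplitz K p')⁻¹ *
        (negToeplitz K q)⁻¹) * (posToeplitz K p)⁻¹) *
      (posToeplitz K p * negToeplitz K q * (posToeplitz K p)⁻¹ * (negToeplitz K q)⁻¹) := by
    rw [map_mul]
    group
  rw [HasSymbol, key, mul_comm c, Units.val_mul, Units.val_mul, Units.val_mul]
  exact (HasDet.conj h' _ (posToeplitz_inv_isContinuousEnd K p)).mul h

lemma HasSymbol.prod {ι : Type*} (s : Finset ι) {p : ι → posUnits R} {q : negUnits R} {c : ι → K}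
    (h : ∀ i ∈ s, HasSymbol (p i) q (c i)) : HasSymbol (∏ i ∈ s, p i) q (∏ i ∈ s, c i) := by
  classical
  induction s using Finset.induction_on with
  | empty => exact hasSymbol_one q
  | insert i s hi ih =>
    rw [Finset.prod_insert hi, Finset.prod_insert hi]
    exact (h i (Finset.mem_insert_self i s)).mul
      (ih fun j hj => h j (Finset.mem_insert_of_mem hj))

/-- The cocycle of the central extension, for `f = q p` and `g = q' p'`: the determinant of
`T_f T_g T_{fg}⁻¹` is the symbol of `p` and `q'`. -/
lemma HasSymbol.cocycle {p p' : posUnits R} {q q' : negUnits R} {c : K} (h : HasSymbol p q' c) :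
    HasDet (↑((negToeplitz K q * posToeplitz K p) * (negToeplitz K q' * posToeplitz K p') *
      (negToeplitz K (q * q') * posToeplitz K (p * p'))⁻¹) : Module.End K (Vplus K R)) c := by
  have key : (negToeplitz K q * posToeplitz K p) * (negToeplitz K q' * posToeplitz K p') *
      (negToeplitz K (q * q') * posToeplitz K (p * p'))⁻¹ =
      negToeplitz K q * (posToeplitz K p * negToeplitz K q' * (posToeplitz K p)⁻¹ *
        (negToeplitz K q')⁻¹) * (negToeplitz K q)⁻¹ := by
    rw [map_mul, map_mul]
    group
  rw [key, Units.val_mul, Units.val_mul]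
  exact HasDet.conj h _ (negToeplitz_inv_isContinuousEnd K q)

end HasDet

/-! ### The exact sequence of relative quotients -/

section RelQuot

variable {K : Type*} [CommRing K] {V : Type*} [AddCommGroup V] [Module K V]

lemma relProj_surjective (A : Submodule K V) {M M' : Submodule K V} (h : M' ≤ M) :
    Function.Surjective (relProj A h) := by
  intro q
  obtain ⟨v, rfl⟩ := Submodule.mkQ_surjective _ q
  exact ⟨Submodule.mkQ _ v, rfl⟩

lemma relIncl_injective {A M : Submodule K V} (M' : Submodule K V) (h : M ≤ A) :
    Function.Injective (relIncl M' h) := by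
  rw [← LinearMap.ker_eq_bot, LinearMap.ker_eq_bot']
  intro q hq
  obtain ⟨v, rfl⟩ := Submodule.mkQ_surjective _ q
  have h' : (M'.submoduleOf A).mkQ (Submodule.inclusion h v) = 0 := hq
  rw [Submodule.mkQ_apply, Submodule.Quotient.mk_eq_zero] at h' ⊢
  exact h'

lemma ker_relProj {A M M' : Submodule K V} (h : M' ≤ M) (hA : M ≤ A) :
    LinearMap.ker (relProj A h) = LinearMap.range (relIncl M' hA) := by
  ext q
  obtain ⟨v, rfl⟩ := Submodule.mkQ_surjective _ q
  constructor
  · intro hq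
    have hv : (M.submoduleOf A).mkQ v = 0 := hq
    rw [Submodule.mkQ_apply, Submodule.Quotient.mk_eq_zero] at hv
    exact ⟨(M'.submoduleOf M).mkQ ⟨v, hv⟩, rfl⟩
  · rintro ⟨w, hw⟩
    obtain ⟨m, rfl⟩ := Submodule.mkQ_surjective _ w
    rw [← hw]
    change (M.submoduleOf A).mkQ (Submodule.inclusion hA m) = 0
    rw [Submodule.mkQ_apply, Submodule.Quotient.mk_eq_zero]
    exact m.2

/-- Over a local ring, the kernel `M / M'` of `A / M' → A / M` is finite free when both quotients
are. -/
lemma relQuot_finite_free [IsLocalRing K] {A M M' : Submodule K V} (h : M' ≤ M) (hA : M ≤ A)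
    [Module.Free K (RelQuot K A M)] [Module.Free K (RelQuot K A M')]
    [Module.Finite K (RelQuot K A M')] :
    Module.Finite K (RelQuot K M M') ∧ Module.Free K (RelQuot K M M') := by
  obtain ⟨s, hs⟩ := Module.projective_lifting_property (relProj A h) LinearMap.id
    (relProj_surjective A h)
  have hex : Function.Exact (relIncl M' hA) (relProj A h) :=
    LinearMap.exact_iff.2 (ker_relProj h hA)
  have hsplit : (Function.Injective (relIncl M' hA) ∧
        ∃ l, relProj A h ∘ₗ l = LinearMap.id) ↔
      (Function.Surjective (relProj A h) ∧ ∃ l, l ∘ₗ relIncl M' hA = LinearMap.id) :=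
    (hex.split_tfae').out 0 1
  obtain ⟨-, l, hl⟩ := hsplit.1 ⟨relIncl_injective M' hA, s, hs⟩
  have hfin : Module.Finite K (RelQuot K M M') :=
    Module.Finite.of_surjective l fun x => ⟨relIncl M' hA x, LinearMap.congr_fun hl x⟩
  have hproj : Module.Projective K (RelQuot K M M') :=
    Module.Projective.of_split (relIncl M' hA) l hl
  exact ⟨hfin, Module.free_of_flat_of_isLocalRing⟩

lemma coe_detTransport (e : V ≃ₗ[K] V) {A A' M M' : Submodule K V}
    (hA : A.map (e : V →ₗ[K] V) = A') (hM : M.map (e : V →ₗ[K] V) = M') (y : DetLine K A M) :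
    (detTransport e hA hM y : ExteriorAlgebra K (RelQuot K A' M')) =
      ExteriorAlgebra.map (relEquiv e hA hM).toLinearMap
        (y : ExteriorAlgebra K (RelQuot K A M)) := by
  rw [← coe_exteriorPower_map]
  rfl

end RelQuot

/-! ### The canonical lift -/

section CanonicalLift

variable {K : Type*} [CommRing K] {R : Type*} [CommRing R] [Algebra K R]

lemma mem_mulVplus_iff {f : R⸨X⸩ˣ} {v : R⸨X⸩} :
    v ∈ mulVplus K f ↔ ∃ w : Vplus K R, (f : R⸨X⸩) * (w : R⸨X⸩) = v := by
  constructor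
  · rintro ⟨w, hw, rfl⟩
    exact ⟨⟨w, hw⟩, rfl⟩
  · rintro ⟨w, rfl⟩
    exact ⟨w, w.2, rfl⟩

variable {f : R⸨X⸩ˣ} (T : (Module.End K (Vplus K R))ˣ)
  (hT : (T : Module.End K (Vplus K R)) = toeplitz K (f : R⸨X⸩))

/-- For `M` contained in `R[[z]]` and in `f R[[z]]`, the projection onto `R[[z]]` is the identity
on `M`. If the Toeplitz operator with symbol `f` is invertible, it induces an isomorphism
`f R[[z]] / M ≃ R[[z]] / M`. -/
def relPosPart {M : Submodule K R⸨X⸩} (h₁ : M ≤ Vplus K R) (h₂ : M ≤ mulVplus K f) :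
    RelQuot K (mulVplus K f) M ≃ₗ[K] RelQuot K (Vplus K R) M :=
  LinearEquiv.ofBijective
    (Submodule.mapQ (M.submoduleOf (mulVplus K f)) (M.submoduleOf (Vplus K R))
      (posPart K ∘ₗ (mulVplus K f).subtype) (by
        intro v hv
        have h : (posPart K (v : R⸨X⸩) : R⸨X⸩) = v := posPart_of_mem K (h₁ hv)
        change (posPart K (v : R⸨X⸩) : R⸨X⸩) ∈ M
        rw [h]
        exact hv)) (by
    constructor
    · rw [← LinearMap.ker_eq_bot, LinearMap.ker_eq_bot']
      intro x hx
      obtain ⟨⟨v, hv⟩, rfl⟩ := Submodule.mkQ_surjective _ x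
      have hx' : (M.submoduleOf (Vplus K R)).mkQ (posPart K v) = 0 := hx
      rw [Submodule.mkQ_apply, Submodule.Quotient.mk_eq_zero] at hx'
      have hm : (posPart K v : R⸨X⸩) ∈ M := hx'
      obtain ⟨w, rfl⟩ := mem_mulVplus_iff.1 hv
      obtain ⟨w', hw'⟩ := mem_mulVplus_iff.1 (h₂ hm)
      have heq : w' = w := by
        have : (T : Module.End K (Vplus K R)) w' = (T : Module.End K (Vplus K R)) w := by
          rw [hT, toeplitz_apply, toeplitz_apply, hw', posPart_coe]
        have h := congrArg (↑T⁻¹ : Module.End K (Vplus K R)) this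
        rwa [← Module.End.mul_apply, ← Module.End.mul_apply, Units.inv_mul] at h
      rw [Submodule.mkQ_apply, Submodule.Quotient.mk_eq_zero]
      change (f : R⸨X⸩) * (w : R⸨X⸩) ∈ M
      rw [← heq, hw']
      exact hm
    · intro x
      obtain ⟨v, rfl⟩ := Submodule.mkQ_surjective _ x
      refine ⟨Submodule.mkQ _ ⟨(f : R⸨X⸩) * ((↑T⁻¹ : Module.End K (Vplus K R)) v : R⸨X⸩),
        mem_mulVplus_iff.2 ⟨_, rfl⟩⟩, ?_⟩
      change (M.submoduleOf (Vplus K R)).mkQ (toeplitz K (f : R⸨X⸩)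
        ((↑T⁻¹ : Module.End K (Vplus K R)) v)) = _
      rw [← hT, ← Module.End.mul_apply, Units.mul_inv, Module.End.one_apply])

lemma relProj_comp_relPosPart {M M' : Submodule K R⸨X⸩} (h : M' ≤ M) (h₁ : M ≤ Vplus K R)
    (h₂ : M ≤ mulVplus K f) :
    relProj (Vplus K R) h ∘ₗ (relPosPart T hT (h.trans h₁) (h.trans h₂)).toLinearMap =
      (relPosPart T hT h₁ h₂).toLinearMap ∘ₗ relProj (mulVplus K f) h := by
  apply Submodule.linearMap_qext
  rfl

lemma relPosPart_comp_relIncl {M M' : Submodule K R⸨X⸩} (h : M' ≤ M) (h₁ : M ≤ Vplus K R)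
    (h₂ : M ≤ mulVplus K f) :
    (relPosPart T hT (h.trans h₁) (h.trans h₂)).toLinearMap ∘ₗ relIncl M' h₂ =
      relIncl M' h₁ := by
  apply Submodule.linearMap_qext
  ext1 v
  change (M'.submoduleOf (Vplus K R)).mkQ (posPart K (v : R⸨X⸩)) =
    (M'.submoduleOf (Vplus K R)).mkQ (Submodule.inclusion h₁ v)
  congr 1
  exact Subtype.ext (posPart_of_mem K (h₁ v.2))

/-- The isomorphism of determinant lines induced by the projection onto `R[[z]]`. -/
def canonicalIso {M : Submodule K R⸨X⸩} (hM : Admissible K f M) :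
    DetLine K (mulVplus K f) M ≃ₗ[K] DetLine K (Vplus K R) M :=
  topPowerEquiv (relPosPart T hT hM.le_left hM.le_right)

lemma coe_canonicalIso {M : Submodule K R⸨X⸩} (hM : Admissible K f M)
    (y : DetLine K (mulVplus K f) M) :
    (canonicalIso T hT hM y : ExteriorAlgebra K (RelQuot K (Vplus K R) M)) =
      ExteriorAlgebra.map (relPosPart T hT hM.le_left hM.le_right).toLinearMap
        (y : ExteriorAlgebra K (RelQuot K (mulVplus K f) M)) :=
  coe_topPowerEquiv _ _

/-- A lift which is `c` times the isomorphism induced by the projection onto `R[[z]]`. -/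
def IsScaled (σ : DetLift K f) (c : Kˣ) : Prop :=
  ∀ (M : Submodule K R⸨X⸩) (hM : Admissible K f M) (y : DetLine K (mulVplus K f) M),
    σ.toEquiv M hM y = (c : K) • canonicalIso T hT hM y

/-- The quotient `f V⁺ / z ^ N V⁺` is free since `relPosPart` identifies it with `V⁺ / z ^ N V⁺`. -/
lemma admissible_lattice [Module.Free K R] {f : R⸨X⸩ˣ} (T : (Module.End K (Vplus K R))ˣ)
    (hT : (T : Module.End K (Vplus K R)) = toeplitz K (f : R⸨X⸩))
    {N : ℕ} (hN : lattice K R N ≤ mulVplus K f) :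
    Admissible K f (lattice K R N) := by
  have h₁ : lattice K R (N : ℤ) ≤ Vplus K R := lattice_anti K (by positivity)
  have hfree : Module.Free K (RelQuot K (Vplus K R) (lattice K R N)) :=
    inferInstanceAs (Module.Free K (Vplus K R ⧸ posLattice K R N))
  exact ⟨h₁, hN, ⟨N, le_rfl⟩, hfree, Module.Free.of_equiv (relPosPart T hT h₁ hN).symm⟩

variable [Module.Finite K R]

lemma Admissible.finite_left {M : Submodule K R⸨X⸩} (hM : Admissible K f M) :
    Module.Finite K (RelQuot K (Vplus K R) M) := by
  obtain ⟨N, hN⟩ := hM.isOpen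
  exact finite_quot K (N := N.toNat)
    fun v hv => hN (lattice_anti K (Int.self_le_toNat N) hv)

lemma Admissible.finite_right {f : R⸨X⸩ˣ} (T : (Module.End K (Vplus K R))ˣ)
    (hT : (T : Module.End K (Vplus K R)) = toeplitz K (f : R⸨X⸩))
    {M : Submodule K R⸨X⸩} (hM : Admissible K f M) :
    Module.Finite K (RelQuot K (mulVplus K f) M) :=
  have := hM.finite_left
  Module.Finite.equiv (relPosPart T hT hM.le_left hM.le_right).symm

variable [IsLocalRing K]

/-- Multiples of the isomorphisms induced by the projection onto `R[[z]]` form a lift. -/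
lemma exists_isScaled (c : Kˣ) : ∃ σ : DetLift K f, IsScaled T hT σ c := by
  refine ⟨⟨fun M hM => (canonicalIso T hT hM).trans (LinearEquiv.smulOfUnit c), ?_⟩,
    fun M hM y => rfl⟩
  intro M M' hM hM' hle u v x huv y hy
  have := hM.free_left
  have := hM'.free_left
  have := hM'.finite_left
  obtain ⟨hfin, hfree⟩ := relQuot_finite_free hle hM.le_left
  set φ := (relPosPart T hT hM.le_left hM.le_right).toLinearMap with hφ
  set φ' := (relPosPart T hT hM'.le_left hM'.le_right).toLinearMap with hφ'
  have huv' : ExteriorAlgebra.map (relProj (Vplus K R) hle)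
      ((c : K) • ExteriorAlgebra.map φ' (u : ExteriorAlgebra K (RelQuot K (mulVplus K f) M'))) =
      ExteriorAlgebra.map (relProj (Vplus K R) hle)
        (v : ExteriorAlgebra K (RelQuot K (Vplus K R) M')) := by
    have h := congrArg Subtype.val huv
    change (c : K) • ((canonicalIso T hT hM _ : DetLine K (Vplus K R) M) :
      ExteriorAlgebra K (RelQuot K (Vplus K R) M)) = _ at h
    rw [coe_canonicalIso, coe_exteriorPower_map] at h
    refine Eq.trans ?_ (h.trans (coe_exteriorPower_map _ _ _))
    rw [map_smul, ← AlgHom.comp_apply, ← AlgHom.comp_apply, ExteriorAlgebra.map_comp_map,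
      ExteriorAlgebra.map_comp_map, relProj_comp_relPosPart]
  change (c : K) • ((canonicalIso T hT hM' y : DetLine K (Vplus K R) M') :
    ExteriorAlgebra K (RelQuot K (Vplus K R) M')) = _
  rw [coe_canonicalIso, hy, map_mul, ← AlgHom.comp_apply _ _
      (x : ExteriorAlgebra K (RelQuot K M M')),
    ExteriorAlgebra.map_comp_map, relPosPart_comp_relIncl T hT hle hM.le_left hM.le_right,
    ← smul_mul_assoc]
  exact mul_map_eq_of_map_eq (relProj_surjective _ hle) (ker_relProj hle hM.le_left) huv' x

/-- The scalars by which a lift differs from the canonical one agree for `M' ≤ M`: the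
compatibility is applied to elements whose product generates the determinant line for `M'`. -/
lemma scale_eq_of_le (σ : DetLift K f) {M M' : Submodule K R⸨X⸩} (hM : Admissible K f M)
    (hM' : Admissible K f M') (hle : M' ≤ M) {c c' : K}
    (hc : ∀ y, σ.toEquiv M hM y = c • canonicalIso T hT hM y)
    (hc' : ∀ y, σ.toEquiv M' hM' y = c' • canonicalIso T hT hM' y) : c = c' := by
  have := hM.free_right
  have := hM'.free_right
  have := Admissible.finite_right T hT hM
  have := Admissible.finite_right T hT hM'
  obtain ⟨hfin, hfree⟩ := relQuot_finite_free hle hM.le_right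
  obtain ⟨u, x, y, hy, hcancel⟩ := exists_mul_map_generator (relIncl_injective M' hM.le_right)
    (relProj_surjective (mulVplus K f) hle) (ker_relProj hle hM.le_right)
  set φ := relPosPart T hT hM.le_left hM.le_right with hφ
  set φ' := relPosPart T hT hM'.le_left hM'.le_right with hφ'
  let v : ⋀[K]^(finrank K (RelQuot K (Vplus K R) M)) (RelQuot K (Vplus K R) M') :=
    c • LinearEquiv.ofEq (⋀[K]^(finrank K (RelQuot K (mulVplus K f) M)) (RelQuot K (Vplus K R) M'))
      _ (by rw [φ.finrank_eq]) (exteriorPower.map _ φ'.toLinearMap u)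
  have hv : (v : ExteriorAlgebra K (RelQuot K (Vplus K R) M')) =
      c • ExteriorAlgebra.map φ'.toLinearMap
        (u : ExteriorAlgebra K (RelQuot K (mulVplus K f) M')) := by
    rw [← coe_exteriorPower_map]
    rfl
  have huv : σ.toEquiv M hM (exteriorPower.map _ (relProj (mulVplus K f) hle) u) =
      exteriorPower.map _ (relProj (Vplus K R) hle) v := by
    rw [hc]
    apply Subtype.ext
    rw [Submodule.coe_smul, coe_canonicalIso, coe_exteriorPower_map, coe_exteriorPower_map, hv,
      map_smul, ← AlgHom.comp_apply, ← AlgHom.comp_apply, ExteriorAlgebra.map_comp_map,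
      ExteriorAlgebra.map_comp_map, relProj_comp_relPosPart T hT hle hM.le_left hM.le_right]
  have h := σ.compat M M' hM hM' hle u v x huv y hy
  apply hcancel
  apply (canonicalIso T hT hM').injective
  rw [map_smul, map_smul, ← hc']
  apply Subtype.ext
  rw [h, hv, Submodule.coe_smul, coe_canonicalIso, hy, map_mul, ← AlgHom.comp_apply _ _
    (x : ExteriorAlgebra K (RelQuot K M M')), ExteriorAlgebra.map_comp_map,
    relPosPart_comp_relIncl T hT hle hM.le_left hM.le_right, smul_mul_assoc]

variable [Module.Free K R]

/-- All lifts are multiples of the lift induced by the projection onto `R[[z]]`. -/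
lemma exists_scale (σ : DetLift K f) : ∃ c : Kˣ, IsScaled T hT σ c := by
  have hex : ∀ (M : Submodule K R⸨X⸩) (hM : Admissible K f M), ∃ c : Kˣ,
      ∀ y, σ.toEquiv M hM y = (c : K) • canonicalIso T hT hM y := by
    intro M hM
    have := hM.free_right
    have := Admissible.finite_right T hT hM
    exact exists_unit_smul_eq finrank_detPower _ _
  by_cases hne : ∃ M : Submodule K R⸨X⸩, Admissible K f M
  · obtain ⟨M₀, hM₀⟩ := hne
    obtain ⟨c, hc⟩ := hex M₀ hM₀
    refine ⟨c, fun M hM y => ?_⟩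
    obtain ⟨c', hc'⟩ := hex M hM
    obtain ⟨N₀, hN₀⟩ := hM₀.isOpen
    obtain ⟨N, hN⟩ := hM.isOpen
    have hle₀ : lattice K R ((max N₀ N).toNat : ℤ) ≤ M₀ :=
      (lattice_anti K ((le_max_left _ _).trans (Int.self_le_toNat _))).trans hN₀
    have hle : lattice K R ((max N₀ N).toNat : ℤ) ≤ M :=
      (lattice_anti K ((le_max_right _ _).trans (Int.self_le_toNat _))).trans hN
    have hadm := admissible_lattice T hT (hle.trans hM.le_right)
    obtain ⟨d, hd⟩ := hex _ hadm
    rw [scale_eq_of_le T hT σ hM₀ hadm hle₀ hc hd, ← scale_eq_of_le T hT σ hM hadm hle hc' hd]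
    exact hc' y
  · exact ⟨1, fun M hM => absurd ⟨M, hM⟩ hne⟩

end CanonicalLift

/-! ### Products of lifts and commutators -/

section Product

variable {K : Type*} [CommRing K] {R : Type*} [CommRing R] [Algebra K R]

variable {f g h : R⸨X⸩ˣ} (e : h = f * g) {Tf Tg Th : (Module.End K (Vplus K R))ˣ}
  (hTf : (Tf : Module.End K (Vplus K R)) = toeplitz K (f : R⸨X⸩))
  (hTg : (Tg : Module.End K (Vplus K R)) = toeplitz K (g : R⸨X⸩))
  (hTh : (Th : Module.End K (Vplus K R)) = toeplitz K (h : R⸨X⸩))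
  {M M₁ : Submodule K R⸨X⸩} (hM₁ : M.map (homothety K f : R⸨X⸩ →ₗ[K] R⸨X⸩) = M₁)

include e hTf hTg hTh hM₁

/-- The defect `T_f T_g T_{fg}⁻¹` is the identity on `f M`. -/
lemma toeplitz_defect_fixes (hg : Admissible K g M) (hf : Admissible K f M₁)
    (hh : Admissible K h M₁) : ∀ v ∈ M₁.submoduleOf (Vplus K R),
      (↑(Tf * Tg * Th⁻¹) : Module.End K (Vplus K R)) v = v := by
  subst hM₁
  rintro ⟨v, hv⟩ ⟨m, hm, rfl⟩
  obtain ⟨w, rfl⟩ := mem_mulVplus_iff.1 (hg.le_right hm)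
  have hgw : toeplitz K (g : R⸨X⸩) w = ⟨(g : R⸨X⸩) * (w : R⸨X⸩), hg.le_left hm⟩ :=
    Subtype.ext (posPart_of_mem K (hg.le_left hm))
  have hfw : toeplitz K (f : R⸨X⸩) ⟨(g : R⸨X⸩) * (w : R⸨X⸩), hg.le_left hm⟩ =
      ⟨(f : R⸨X⸩) * ((g : R⸨X⸩) * (w : R⸨X⸩)), hv⟩ :=
    Subtype.ext (posPart_of_mem K hv)
  have hhw : toeplitz K (h : R⸨X⸩) w = ⟨(f : R⸨X⸩) * ((g : R⸨X⸩) * (w : R⸨X⸩)), hv⟩ := by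
    apply Subtype.ext
    rw [toeplitz_apply, e, Units.val_mul, mul_assoc]
    exact posPart_of_mem K hv
  change (↑(Tf * Tg * Th⁻¹) : Module.End K (Vplus K R))
    ⟨(f : R⸨X⸩) * ((g : R⸨X⸩) * (w : R⸨X⸩)), hv⟩ =
    ⟨(f : R⸨X⸩) * ((g : R⸨X⸩) * (w : R⸨X⸩)), hv⟩
  rw [← hhw, ← hTh, ← Module.End.mul_apply, ← Units.val_mul, inv_mul_cancel_right,
    Units.val_mul, Module.End.mul_apply, hTf, hTg, hTh, hgw, hfw, hhw]

/-- The two isomorphisms `g V⁺ / M → V⁺ / f M` obtained by applying `f` and the projections in the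
two possible orders differ by `T_f T_g T_{fg}⁻¹`. -/
lemma relPosPart_comp_relEquiv (hg : Admissible K g M) (hf : Admissible K f M₁)
    (hh : Admissible K h M₁)
    (hX : M₁.submoduleOf (Vplus K R) ≤ (M₁.submoduleOf (Vplus K R)).comap
      (↑(Tf * Tg * Th⁻¹) : Module.End K (Vplus K R))) :
    (relPosPart Tf hTf hf.le_left hf.le_right).toLinearMap ∘ₗ
        (relEquiv (homothety K f) rfl hM₁).toLinearMap ∘ₗ
        (relPosPart Tg hTg hg.le_left hg.le_right).toLinearMap =
      (M₁.submoduleOf (Vplus K R)).mapQ (M₁.submoduleOf (Vplus K R))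
          (↑(Tf * Tg * Th⁻¹) : Module.End K (Vplus K R)) hX ∘ₗ
        (relPosPart Th hTh hh.le_left hh.le_right).toLinearMap ∘ₗ
        (relEquiv (homothety K f) (map_mulVplus K e) hM₁).toLinearMap := by
  apply Submodule.linearMap_qext
  ext1 ⟨v, hv⟩
  obtain ⟨w, rfl⟩ := mem_mulVplus_iff.1 hv
  change (M₁.submoduleOf (Vplus K R)).mkQ
      (toeplitz K (f : R⸨X⸩) (toeplitz K (g : R⸨X⸩) w)) =
    (M₁.submoduleOf (Vplus K R)).mkQ ((↑(Tf * Tg * Th⁻¹) : Module.End K (Vplus K R))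
      (posPart K ((f : R⸨X⸩) * ((g : R⸨X⸩) * (w : R⸨X⸩)))))
  have hhw : posPart K ((f : R⸨X⸩) * ((g : R⸨X⸩) * (w : R⸨X⸩))) =
      (Th : Module.End K (Vplus K R)) w := by
    rw [hTh, toeplitz_apply, e, Units.val_mul, mul_assoc]
  rw [hhw, ← Module.End.mul_apply (↑(Tf * Tg * Th⁻¹) : Module.End K (Vplus K R)), ← Units.val_mul,
    inv_mul_cancel_right, Units.val_mul, Module.End.mul_apply, hTf, hTg]

variable [Module.Free K R] [Module.Finite K R] [IsLocalRing K]

/-- The cocycle of the canonical lifts is the determinant of `T_f T_g T_{fg}⁻¹`. -/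
lemma canonicalIso_product {x : K}
    (hx : HasDet (↑(Tf * Tg * Th⁻¹) : Module.End K (Vplus K R)) x)
    (hg : Admissible K g M) (hf : Admissible K f M₁)
    (hh : Admissible K h M₁) (y : DetLine K (mulVplus K g) M) :
    canonicalIso Tf hTf hf (detTransport (homothety K f) rfl hM₁ (canonicalIso Tg hTg hg y)) =
      x • canonicalIso Th hTh hh (detTransport (homothety K f) (map_mulVplus K e) hM₁ y) := by
  have hfix := toeplitz_defect_fixes e hTf hTg hTh hM₁ hg hf hh
  have hfree : Module.Free K (Vplus K R ⧸ M₁.submoduleOf (Vplus K R)) := hf.free_left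
  have hfin : Module.Finite K (Vplus K R ⧸ M₁.submoduleOf (Vplus K R)) := hf.finite_left
  have hopen : ∃ N : ℕ, posLattice K R N ≤ M₁.submoduleOf (Vplus K R) := by
    obtain ⟨N, hN⟩ := hf.isOpen
    exact ⟨N.toNat, fun v hv => hN (lattice_anti K (Int.self_le_toNat N) hv)⟩
  have hdet := hx.detQuot_eq hopen hfix
  rw [detQuot] at hdet
  rw [← hdet, ← exteriorPower_map_eq_det_smul]
  apply Subtype.ext
  rw [coe_canonicalIso, coe_detTransport, coe_canonicalIso, coe_exteriorPower_map,
    coe_canonicalIso, coe_detTransport]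
  simp only [← AlgHom.comp_apply, ExteriorAlgebra.map_comp_map]
  rw [relPosPart_comp_relEquiv e hTf hTg hTh hM₁ hg hf hh]

/-- `(c σ) (d τ) = (c d x) ρ` for the canonical lifts `σ`, `τ`, `ρ`. -/
lemma product_eq {x : K} (hx : HasDet (↑(Tf * Tg * Th⁻¹) : Module.End K (Vplus K R)) x)
    {σ : DetLift K f} {τ : DetLift K g} {c d : Kˣ} (hσ : IsScaled Tf hTf σ c)
    (hτ : IsScaled Tg hTg τ d)
    (hg : Admissible K g M) (hf : Admissible K f M₁)
    (hh : Admissible K h M₁) (y : DetLine K (mulVplus K g) M) :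
    σ.toEquiv M₁ hf (detTransport (homothety K f) rfl hM₁ (τ.toEquiv M hg y)) =
      ((c : K) * d * x) •
        canonicalIso Th hTh hh (detTransport (homothety K f) (map_mulVplus K e) hM₁ y) := by
  rw [hσ, hτ, map_smul, map_smul, canonicalIso_product e hTf hTg hTh hM₁ hx hg hf hh, smul_smul,
    smul_smul]

end Product

section Commutator

variable {K : Type*} [CommRing K] {R : Type*} [CommRing R] [Algebra K R]

/-- The condition defining products of lifts is not vacuous: some `M` is admissible for `g`, while
`f M` is admissible for `f` and `f g`. -/
lemma exists_admissible_triple [Module.Free K R] {f g h : R⸨X⸩ˣ} (e : h = f * g)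
    {Tf Th : (Module.End K (Vplus K R))ˣ}
    (hTf : (Tf : Module.End K (Vplus K R)) = toeplitz K (f : R⸨X⸩))
    (hTh : (Th : Module.End K (Vplus K R)) = toeplitz K (h : R⸨X⸩)) :
    ∃ M M₁ : Submodule K R⸨X⸩, M.map (homothety K f : R⸨X⸩ →ₗ[K] R⸨X⸩) = M₁ ∧
      Admissible K g M ∧ Admissible K f M₁ ∧ Admissible K h M₁ := by
  obtain ⟨D, hD⟩ := exists_mem_lattice K (f : R⸨X⸩)
  obtain ⟨D', hD'⟩ := exists_mem_lattice K (↑f⁻¹ : R⸨X⸩)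
  obtain ⟨D'', hD''⟩ := exists_mem_lattice K (↑h⁻¹ : R⸨X⸩)
  have hmul : ∀ (u : R⸨X⸩ˣ) (d : ℕ), (↑u⁻¹ : R⸨X⸩) ∈ lattice K R (-(d : ℤ)) →
      ∀ N : ℕ, d ≤ N → lattice K R (N : ℤ) ≤ mulVplus K u := by
    intro u d hd N hN v hv
    refine mem_mulVplus_iff.2 ⟨⟨↑u⁻¹ * v, ?_⟩, by simp⟩
    exact lattice_anti K (by omega) (mul_mem_lattice K hd hv)
  let N : ℕ := D' + D''
  have hf : Admissible K f (lattice K R (N : ℤ)) :=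
    admissible_lattice Tf hTf (hmul f D' hD' N (by omega))
  have hh : Admissible K h (lattice K R (N : ℤ)) :=
    admissible_lattice Th hTh (hmul h D'' hD'' N (by omega))
  let M : Submodule K R⸨X⸩ := (lattice K R (N : ℤ)).comap (homothety K f : R⸨X⸩ →ₗ[K] R⸨X⸩)
  have hM : M.map (homothety K f : R⸨X⸩ →ₗ[K] R⸨X⸩) = lattice K R (N : ℤ) :=
    Submodule.map_comap_eq_of_surjective (homothety K f).surjective _
  have hmem : ∀ v, v ∈ M ↔ (f : R⸨X⸩) * v ∈ lattice K R (N : ℤ) := fun v => Iff.rfl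
  refine ⟨M, _, hM, ⟨?_, ?_, ⟨N + D, ?_⟩, ?_, ?_⟩, hf, hh⟩
  · intro v hv
    have h₁ := mul_mem_lattice K hD' ((hmem v).1 hv)
    rw [Units.inv_mul_cancel_left] at h₁
    exact lattice_anti K (by omega) h₁
  · intro v hv
    obtain ⟨w, hw⟩ := mem_mulVplus_iff.1 (hh.le_right ((hmem v).1 hv))
    refine mem_mulVplus_iff.2 ⟨w, ?_⟩
    rw [e, Units.val_mul, mul_assoc] at hw
    exact (Units.mul_right_inj f).1 hw
  · intro v hv
    have h₁ := mul_mem_lattice K hD hv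
    rwa [neg_add_cancel_comm_assoc] at h₁
  · have := hf.free_right
    exact Module.Free.of_equiv (relEquiv (homothety K f) rfl hM).symm
  · have := hh.free_right
    exact Module.Free.of_equiv (relEquiv (homothety K f) (map_mulVplus K e) hM).symm

variable [Module.Free K R] [Module.Finite K R] [IsLocalRing K]

lemma exists_isProduct {f g h : R⸨X⸩ˣ} (e : h = f * g) {Tf Tg Th : (Module.End K (Vplus K R))ˣ}
    (hTf : (Tf : Module.End K (Vplus K R)) = toeplitz K (f : R⸨X⸩))
    (hTg : (Tg : Module.End K (Vplus K R)) = toeplitz K (g : R⸨X⸩))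
    (hTh : (Th : Module.End K (Vplus K R)) = toeplitz K (h : R⸨X⸩)) {x : Kˣ}
    (hx : HasDet (↑(Tf * Tg * Th⁻¹) : Module.End K (Vplus K R)) (x : K))
    {σ : DetLift K f} {τ : DetLift K g} {c d : Kˣ} (hσ : IsScaled Tf hTf σ c)
    (hτ : IsScaled Tg hTg τ d) : ∃ ρ : DetLift K h, IsProduct e σ τ ρ := by
  obtain ⟨ρ, hρ⟩ := exists_isScaled Th hTh (c * d * x)
  refine ⟨ρ, fun M M₁ hM₁ hg hf hh y => ?_⟩
  rw [product_eq e hTf hTg hTh hM₁ hx hσ hτ hg hf hh, hρ, Units.val_mul, Units.val_mul]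

/-- A product of the lifts `c σ` and `d τ`, for canonical `σ` and `τ`, is `c d x` times the
canonical lift. -/
lemma isScaled_of_isProduct {f g h : R⸨X⸩ˣ} (e : h = f * g)
    {Tf Tg Th : (Module.End K (Vplus K R))ˣ}
    (hTf : (Tf : Module.End K (Vplus K R)) = toeplitz K (f : R⸨X⸩))
    (hTg : (Tg : Module.End K (Vplus K R)) = toeplitz K (g : R⸨X⸩))
    (hTh : (Th : Module.End K (Vplus K R)) = toeplitz K (h : R⸨X⸩)) {x : Kˣ}
    (hx : HasDet (↑(Tf * Tg * Th⁻¹) : Module.End K (Vplus K R)) (x : K))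
    {σ : DetLift K f} {τ : DetLift K g} {ρ : DetLift K h} {c d : Kˣ} (hσ : IsScaled Tf hTf σ c)
    (hτ : IsScaled Tg hTg τ d) (hρ : IsProduct e σ τ ρ) : IsScaled Th hTh ρ (c * d * x) := by
  obtain ⟨r, hr⟩ := exists_scale Th hTh ρ
  obtain ⟨M, M₁, hM₁, hg, hf, hh⟩ := exists_admissible_triple e hTf hTh
  have := hg.free_right
  have := Admissible.finite_right Tg hTg hg
  have hgen : ∃ y : DetLine K (mulVplus K g) M, ∀ a b : K, a • y = b • y → a = b := by
    have hone : finrank K (DetLine K (mulVplus K g) M) = 1 := finrank_detPower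
    let b := (finBasisOfFinrankEq K _ hone)
    exact ⟨b 0, fun a a' haa => by simpa using congrArg (fun z => b.repr z 0) haa⟩
  obtain ⟨y, hy⟩ := hgen
  have h₁ := hρ M M₁ hM₁ hg hf hh y
  rw [product_eq e hTf hTg hTh hM₁ hx hσ hτ hg hf hh, hr, ← map_smul, ← map_smul, ← map_smul,
    ← map_smul] at h₁
  have hinj : Function.Injective
      (detTransport (homothety K f) (map_mulVplus K e) hM₁) :=
    (topPowerEquiv (relEquiv (homothety K f) (map_mulVplus K e) hM₁)).injective
  have h₂ := hy _ _ (hinj ((canonicalIso Th hTh hh).injective h₁))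
  have : r = c * d * x := Units.ext (by rw [h₂, Units.val_mul, Units.val_mul])
  rwa [← this]

/-- The commutator of `f` and `g` is the quotient of the determinants of `T_f T_g T_{fg}⁻¹` and
`T_g T_f T_{fg}⁻¹`. -/
theorem isCommutator_of_hasDet {f g : R⸨X⸩ˣ} {Tf Tg Th : (Module.End K (Vplus K R))ˣ}
    (hTf : (Tf : Module.End K (Vplus K R)) = toeplitz K (f : R⸨X⸩))
    (hTg : (Tg : Module.End K (Vplus K R)) = toeplitz K (g : R⸨X⸩))
    (hTh : (Th : Module.End K (Vplus K R)) = toeplitz K (↑(f * g) : R⸨X⸩)) {x x' : Kˣ}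
    (hx : HasDet (↑(Tf * Tg * Th⁻¹) : Module.End K (Vplus K R)) (x : K))
    (hx' : HasDet (↑(Tg * Tf * Th⁻¹) : Module.End K (Vplus K R)) (x' : K)) :
    IsCommutator K f g (x / x') := by
  refine ⟨(exists_isScaled Tf hTf 1).nonempty, (exists_isScaled Tg hTg 1).nonempty,
    fun σ τ => ?_⟩
  obtain ⟨c, hσ⟩ := exists_scale Tf hTf σ
  obtain ⟨d, hτ⟩ := exists_scale Tg hTg τ
  refine ⟨exists_isProduct rfl hTf hTg hTh hx hσ hτ,
    exists_isProduct (mul_comm f g) hTg hTf hTh hx' hτ hσ, fun ρ ρ' hρ hρ' M hM y => ?_⟩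
  rw [isScaled_of_isProduct rfl hTf hTg hTh hx hσ hτ hρ M hM,
    isScaled_of_isProduct (mul_comm f g) hTg hTf hTh hx' hτ hσ hρ' M hM, smul_smul,
    ← Units.val_mul]
  congr 2
  rw [mul_comm d c, mul_comm (c * d) x', ← mul_assoc, div_mul_cancel, mul_comm]

/-- The commutator in terms of the factorizations `f = q p` and `g = q' p'` with `q, q'` units of
`R[z⁻¹]` and `p, p'` units of `R[[z]]`. -/
theorem isCommutator_of_hasSymbol {p p' : posUnits R} {q q' : negUnits R} {x x' : Kˣ}
    (hx : HasSymbol p q' (x : K)) (hx' : HasSymbol p' q (x' : K)) :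
    IsCommutator K (q.1 * p.1) (q'.1 * p'.1) (x / x') := by
  have h := hx.cocycle (q := q) (p' := p')
  have h' := hx'.cocycle (q := q') (p' := p)
  rw [mul_comm q' q, mul_comm p' p] at h'
  have hmul : q.1 * p.1 * (q'.1 * p'.1) = (q * q').1 * (p * p').1 := mul_mul_mul_comm _ _ _ _
  have hTh : ((negToeplitz K (q * q') * posToeplitz K (p * p') : (Module.End K (Vplus K R))ˣ) :
      Module.End K (Vplus K R)) = toeplitz K (↑(q.1 * p.1 * (q'.1 * p'.1)) : R⸨X⸩) := by
    rw [hmul, Units.val_mul (q * q').1]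
    exact (toeplitz_factor K (q * q') (p * p')).symm
  have hTf : ((negToeplitz K q * posToeplitz K p : (Module.End K (Vplus K R))ˣ) :
      Module.End K (Vplus K R)) = toeplitz K (↑(q.1 * p.1) : R⸨X⸩) := by
    rw [Units.val_mul q.1]
    exact (toeplitz_factor K q p).symm
  have hTg : ((negToeplitz K q' * posToeplitz K p' : (Module.End K (Vplus K R))ˣ) :
      Module.End K (Vplus K R)) = toeplitz K (↑(q'.1 * p'.1) : R⸨X⸩) := by
    rw [Units.val_mul q'.1]
    exact (toeplitz_factor K q' p').symm
  exact isCommutator_of_hasDet hTf hTg hTh h h'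

end Commutator

/-! ### The symbol of `1 - a z ^ i` -/

section CyclicShift

variable {R : Type*} [CommRing R] {i : ℕ} [NeZero i]

/-- The transpose of multiplication by `w` on `R[w] / (w ^ i - a)` in the basis of monomials: the
cyclic shift of `R ^ i` with weight `a` at the wrap-around. -/
def cyclicShift (i : ℕ) [NeZero i] (a : R) : Module.End R (Fin i → R) where
  toFun x r := (if (r : ℕ) + 1 = i then a else 1) * x (r + 1)
  map_add' x y := by ext r; simp [mul_add]
  map_smul' c x := by ext r; simp [mul_left_comm]

lemma cyclicShift_apply (a : R) (x : Fin i → R) (r : Fin i) :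
    cyclicShift i a x r = (if (r : ℕ) + 1 = i then a else 1) * x (r + 1) := rfl

end CyclicShift

section Geometric

variable (K : Type*) [CommRing K] {R : Type*} [CommRing R] [Algebra K R] {i : ℕ} [NeZero i]

lemma Vplus_ext {u v : Vplus K R} (h : ∀ n : ℕ, (u : R⸨X⸩).coeff (n : ℤ) = (v : R⸨X⸩).coeff n) :
    u = v := by
  ext n
  by_cases hn : n < 0
  · rw [u.2 n hn, v.2 n hn]
  · lift n to ℕ using not_lt.1 hn
    exact h n

/-- The power series with given coefficients. -/
def ofCoeff (u : ℕ → R) : Vplus K R := ⟨_, ofPowerSeries_mem K (PowerSeries.mk u)⟩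

lemma coeff_ofCoeff (u : ℕ → R) (n : ℕ) : (ofCoeff K u : R⸨X⸩).coeff (n : ℤ) = u n :=
  ofPowerSeries_mk_coeff _ n

/-- The power series `(x₀ + x₁ z + ⋯ + x_{i-1} z ^ (i-1)) / (1 - a z ^ i)`. They form the kernel of
the Toeplitz operator with symbol `z⁻ⁱ - a`. -/
def geometric (a : R) : (Fin i → R) →ₗ[K] Vplus K R where
  toFun x := ofCoeff K fun n => a ^ (n / i) * x (Fin.ofNat i n)
  map_add' x y := by
    apply Vplus_ext
    intro n
    rw [Submodule.coe_add, HahnSeries.coeff_add, coeff_ofCoeff, coeff_ofCoeff, coeff_ofCoeff,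
      Pi.add_apply, mul_add]
  map_smul' c x := by
    apply Vplus_ext
    intro n
    rw [RingHom.id_apply, Submodule.coe_smul, HahnSeries.coeff_smul, coeff_ofCoeff, coeff_ofCoeff,
      Pi.smul_apply, mul_smul_comm]

lemma coeff_geometric (a : R) (x : Fin i → R) (n : ℕ) :
    (geometric K a x : R⸨X⸩).coeff (n : ℤ) = a ^ (n / i) * x (Fin.ofNat i n) :=
  coeff_ofCoeff K _ n

lemma truncate_comp_geometric (a : R) :
    truncate K i ∘ₗ geometric K a = (LinearMap.id : (Fin i → R) →ₗ[K] (Fin i → R)) := by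
  refine LinearMap.ext fun x => funext fun r => ?_
  refine (coeff_geometric K a x (r : ℕ)).trans ?_
  rw [Nat.div_eq_of_lt r.2, pow_zero, one_mul, LinearMap.id_apply]
  simp

/-- Multiplication by `1 - a z ^ i` turns `p / (1 - a z ^ i)` into `p`. -/
lemma toeplitz_comp_geometric (a : R) :
    toeplitz K (1 - HahnSeries.single (i : ℤ) a : R⸨X⸩) ∘ₗ geometric K a =
      (geometric K 0 : (Fin i → R) →ₗ[K] Vplus K R) := by
  have hi : 0 < i := Nat.pos_of_ne_zero (NeZero.ne i)
  refine LinearMap.ext fun x => ?_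
  apply Vplus_ext
  intro n
  rw [LinearMap.comp_apply, toeplitz_apply, coeff_posPart K _ (by positivity), sub_mul, one_mul,
    HahnSeries.coeff_sub, coeff_geometric, coeff_geometric, HahnSeries.coeff_single_mul]
  by_cases hn : n < i
  · rw [(geometric K a x).2 _ (by omega), Nat.div_eq_of_lt hn]
    simp
  · obtain ⟨m, rfl⟩ := Nat.exists_eq_add_of_le (not_lt.1 hn)
    have h₁ : (((i + m : ℕ) : ℤ) - (i : ℤ)) = (m : ℤ) := by push_cast; ring
    have h₂ : (i + m) / i = m / i + 1 := Nat.add_div_left m hi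
    have h₃ : Fin.ofNat i (i + m) = Fin.ofNat i m := by
      ext; simp
    rw [h₁, coeff_geometric, h₂, h₃, pow_succ, pow_succ]
    ring

/-- The Toeplitz operator with symbol `z⁻¹` acts on the series `p / (1 - a z ^ i)` through the
cyclic shift. -/
lemma toeplitz_X_geometric (a : R) (x : Fin i → R) :
    toeplitz K (HahnSeries.single (-1 : ℤ) (1 : R)) (geometric K a x) =
      geometric K a (cyclicShift i a x) := by
  have hi : 0 < i := Nat.pos_of_ne_zero (NeZero.ne i)
  apply Vplus_ext
  intro n
  rw [toeplitz_apply, coeff_posPart K _ (by positivity), HahnSeries.coeff_single_mul, one_mul,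
    sub_neg_eq_add, coeff_geometric, cyclicShift_apply]
  have h : ((n : ℤ) + 1) = ((n + 1 : ℕ) : ℤ) := by push_cast; rfl
  rw [h, coeff_geometric]
  have h₁ : Fin.ofNat i (n + 1) = Fin.ofNat i n + 1 := by
    ext; simp [Fin.val_add]
  rw [h₁, ← mul_assoc]
  congr 1
  rw [Nat.succ_div]
  have h₂ : i ∣ n + 1 ↔ ((Fin.ofNat i n : Fin i) : ℕ) + 1 = i := by
    rw [Fin.val_ofNat]
    have hlt := Nat.mod_lt n hi
    constructor
    · intro hd
      by_contra hne
      have : (n + 1) % i = n % i + 1 := by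
        rw [Nat.add_mod_eq_ite]
        have h1 : 1 % i = 1 := Nat.mod_eq_of_lt (by omega)
        rw [h1, if_neg (by omega)]
      omega
    · intro hd
      refine ⟨n / i + 1, ?_⟩
      have := Nat.div_add_mod n i
      rw [mul_add]
      omega
  by_cases hd : i ∣ n + 1
  · rw [if_pos hd, if_pos (h₂.1 hd), pow_succ]
  · rw [if_neg hd, if_neg fun h => hd (h₂.2 h), mul_one, add_zero]

/-- Evaluation of polynomials at `z⁻¹`. -/
def evalInv : R[X] →+* R⸨X⸩ :=
  eval₂RingHom HahnSeries.C (HahnSeries.single (-1 : ℤ) (1 : R))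

lemma evalInv_C (c : R) : evalInv (C c) = HahnSeries.single (0 : ℤ) c := eval₂_C _ _

lemma evalInv_X : evalInv (X : R[X]) = HahnSeries.single (-1 : ℤ) (1 : R) := eval₂_X _ _

lemma evalInv_X_pow (n : ℕ) :
    evalInv (X ^ n : R[X]) = HahnSeries.single (-(n : ℤ)) (1 : R) := by
  rw [map_pow, evalInv_X, HahnSeries.single_pow]
  simp

lemma evalInv_mem_negSubring (Q : R[X]) : evalInv Q ∈ negSubring R := by
  induction Q using Polynomial.induction_on' with
  | add P Q hP hQ =>
    rw [map_add]
    exact add_mem hP hQ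
  | monomial n c =>
    rw [← C_mul_X_pow_eq_monomial, map_mul, evalInv_C, evalInv_X_pow]
    exact mul_mem (single_mem_negSubring le_rfl c) (single_mem_negSubring (by omega) 1)

lemma toeplitz_evalInv_geometric (a : R) (Q : R[X]) (x : Fin i → R) :
    toeplitz K (evalInv Q) (geometric K a x) =
      geometric K a (aeval (cyclicShift i a) Q x) := by
  induction Q using Polynomial.induction_on generalizing x with
  | C c =>
    rw [aeval_C, evalInv_C]
    apply Vplus_ext
    intro n
    rw [toeplitz_apply, coeff_posPart K _ (by positivity), HahnSeries.coeff_single_mul, sub_zero,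
      coeff_geometric, coeff_geometric]
    simp [Module.algebraMap_end_apply, mul_left_comm]
  | add P Q hP hQ =>
    rw [map_add, toeplitz_add, map_add, LinearMap.add_apply, LinearMap.add_apply, map_add,
      ← hP, ← hQ]
  | monomial n c ih =>
    rw [pow_succ, ← mul_assoc, map_mul evalInv (C c * X ^ n),
      toeplitz_mul_of_negative K (evalInv_mem_negSubring _), Module.End.mul_apply,
      map_mul (aeval (cyclicShift i a)) (C c * X ^ n), Module.End.mul_apply, aeval_X, ← ih]
    congr 1
    rw [← toeplitz_X_geometric, evalInv_X]

variable {K}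
variable [Module.Free K R] [Module.Finite K R]

/-- The symbol of `1 - a z ^ i` and `Q(z⁻¹)` is the norm of the determinant of multiplication by
`Q(w)` on `R[w] / (w ^ i - a)`, for `Q` normalized to have determinant `1` when `a = 0`. -/
lemma hasSymbol_one_sub_single {a : R} {p : posUnits R} {q : negUnits R} {Q : R[X]}
    (hp : (p.1 : R⸨X⸩) = 1 - HahnSeries.single (i : ℤ) a) (hq : (q.1 : R⸨X⸩) = evalInv Q)
    (hQ : LinearMap.det (aeval (cyclicShift i (0 : R)) Q) = 1) :
    HasSymbol p q (Algebra.norm K (LinearMap.det (aeval (cyclicShift i a) Q))) := by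
  set A := posToeplitz K p with hA
  set B := negToeplitz K q with hB
  set X : Module.End K (Vplus K R) := ↑(A * B * A⁻¹ * B⁻¹) with hX
  let w : R⸨X⸩ := HahnSeries.single (-(i : ℤ)) (1 : R)
  have hw : w ∈ negSubring R := single_mem_negSubring (by omega) 1
  have hAcoe : (A : Module.End K (Vplus K R)) = toeplitz K (p.1 : R⸨X⸩) := rfl
  have hBcoe : (B : Module.End K (Vplus K R)) = toeplitz K (q.1 : R⸨X⸩) := rfl
  -- `z⁻ⁱ (1 - a z ^ i)` lies in `R[z⁻¹]`, so that its Toeplitz operator commutes with that of `q`.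
  have hwp : w * (p.1 : R⸨X⸩) ∈ negSubring R := by
    rw [hp, mul_sub, mul_one, HahnSeries.single_mul_single, neg_add_cancel]
    exact sub_mem hw (single_mem_negSubring le_rfl _)
  have hwA : toeplitz K w * (A : Module.End K (Vplus K R)) * (B : Module.End K (Vplus K R)) =
      toeplitz K w * (B : Module.End K (Vplus K R)) * (A : Module.End K (Vplus K R)) := by
    rw [hAcoe, hBcoe, ← toeplitz_mul_of_negative K hw, ← toeplitz_mul_of_negative K hwp,
      ← toeplitz_mul_of_negative K hw, ← toeplitz_mul_of_negative K (mul_mem hw q.2.1)]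
    congr 1
    ring
  have hwX : toeplitz K w * X = toeplitz K w := by
    rw [hX, Units.val_mul, Units.val_mul, Units.val_mul, ← mul_assoc, ← mul_assoc, ← mul_assoc, hwA,
      mul_assoc _ (A : Module.End K (Vplus K R)), Units.mul_inv, mul_one,
      mul_assoc _ (B : Module.End K (Vplus K R)), Units.mul_inv, mul_one]
  have hfactor : ∀ v, geometric K (0 : R) (truncate K i (X v - v)) = X v - v := by
    intro v
    apply Vplus_ext
    intro n
    rw [coeff_geometric]
    by_cases hn : n < i
    · rw [Nat.div_eq_of_lt hn, pow_zero, one_mul]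
      change ((X v - v : Vplus K R) : R⸨X⸩).coeff (((n % i : ℕ) : ℤ)) = _
      rw [Nat.mod_eq_of_lt hn]
    · have hpos : n / i ≠ 0 :=
        (Nat.div_pos (not_lt.1 hn) (Nat.pos_of_ne_zero (NeZero.ne i))).ne'
      rw [zero_pow hpos, zero_mul]
      obtain ⟨m, rfl⟩ := Nat.exists_eq_add_of_le (not_lt.1 hn)
      have h : toeplitz K w (X v - v) = 0 := by
        rw [map_sub, ← Module.End.mul_apply, hwX, sub_self]
      have h' := congrArg (fun u : Vplus K R => (u : R⸨X⸩).coeff (m : ℤ)) h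
      simp only [toeplitz_apply] at h'
      rw [coeff_posPart K _ (by positivity), HahnSeries.coeff_single_mul, one_mul] at h'
      rw [show (((i + m : ℕ) : ℤ)) = (m : ℤ) - -(i : ℤ) by push_cast; ring, h']
      rfl
  have hcont : IsContinuousEnd K X := by
    have hc := toeplitz_isContinuousEnd K (R := R)
    exact (((hc p.1).mul (hc q.1)).mul (hc (↑p.1⁻¹ : R⸨X⸩))).mul (hc (↑q.1⁻¹ : R⸨X⸩))
  obtain ⟨N, hN⟩ := hcont i
  have hfix : ∀ v ∈ posLattice K R (max N i), X v = v := by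
    intro v hv
    have h₁ : X v ∈ LinearMap.ker (truncate K i) := by
      rw [ker_truncate]
      exact hN (posLattice_anti K (le_max_left N i) hv)
    have h₂ : v ∈ LinearMap.ker (truncate K i) := by
      rw [ker_truncate]
      exact posLattice_anti K (le_max_right N i) hv
    rw [← sub_eq_zero, ← hfactor, map_sub, h₁, h₂, sub_zero, map_zero]
  refine ⟨max N i, hfix, ?_⟩
  rw [detQuot_eq_det_of_factor X _ hfix (geometric K (0 : R)) (truncate K i)
    (truncate_comp_geometric K 0) hfactor]
  have hcomp : (truncate K i ∘ₗ X ∘ₗ geometric K (0 : R)) ∘ₗ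
      (aeval (cyclicShift i (0 : R)) Q).restrictScalars K =
      (aeval (cyclicShift i a) Q).restrictScalars K := by
    refine LinearMap.ext fun x => ?_
    have hAa : ∀ y : Fin i → R, (A : Module.End K (Vplus K R)) (geometric K a y) =
        geometric K 0 y := by
      intro y
      rw [hAcoe, hp]
      exact LinearMap.congr_fun (toeplitz_comp_geometric K a) y
    have hB₀ : geometric K (0 : R) (aeval (cyclicShift i (0 : R)) Q x) =
        (B : Module.End K (Vplus K R)) (geometric K 0 x) := by
      rw [hBcoe, hq, toeplitz_evalInv_geometric]
    have hXB : X * (B : Module.End K (Vplus K R)) * (A : Module.End K (Vplus K R)) =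
        (A : Module.End K (Vplus K R)) * (B : Module.End K (Vplus K R)) := by
      rw [hX, ← Units.val_mul, ← Units.val_mul, ← Units.val_mul, inv_mul_cancel_right,
        inv_mul_cancel_right]
    change truncate K i (X (geometric K (0 : R) (aeval (cyclicShift i (0 : R)) Q x))) =
      aeval (cyclicShift i a) Q x
    rw [hB₀, ← hAa, ← Module.End.mul_apply, ← Module.End.mul_apply, hXB, Module.End.mul_apply,
      hBcoe, hq, toeplitz_evalInv_geometric, hAa]
    exact LinearMap.congr_fun (truncate_comp_geometric K (0 : R)) _
  have hdet := congrArg LinearMap.det hcomp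
  rwa [LinearMap.det_comp, LinearMap.det_restrictScalars, LinearMap.det_restrictScalars, hQ,
    map_one, mul_one] at hdet

end Geometric

/-! ### The norm of `1 - b w ^ j` on `R[w] / (w ^ i - a)` -/

section WeightedCycle

/-- The product of the `1 - c ξ` over `n`-th roots of unity `ξ`, each taken `d` times. -/
lemma prod_one_sub_mul_pow {L : Type*} [Field L] {η : L} {n : ℕ} (hn : 0 < n)
    (hη : IsPrimitiveRoot η n) (c : L) (d : ℕ) :
    ∏ s ∈ Finset.range (n * d), (1 - c * η ^ s) = (1 - c ^ n) ^ d := by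
  have hone : ∏ s ∈ Finset.range n, (1 - c * η ^ s) = 1 - c ^ n := by
    have h := hη.pow_sub_pow_eq_prod_sub_mul 1 c hn
    rw [one_pow] at h
    rw [h]
    refine Finset.prod_bij (fun s _ => η ^ s) (fun s _ => ?_) (fun s hs t ht hst => ?_)
      (fun ξ hξ => ?_) (fun s _ => by rw [mul_comm])
    · rw [mem_nthRootsFinset hn, ← pow_mul, mul_comm, pow_mul, hη.pow_eq_one, one_pow]
    · exact hη.pow_inj (Finset.mem_range.1 hs) (Finset.mem_range.1 ht) hst
    · have : NeZero n := ⟨hn.ne'⟩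
      obtain ⟨s, hs, rfl⟩ := hη.eq_pow_of_pow_eq_one ((mem_nthRootsFinset hn _).1 hξ)
      exact ⟨s, Finset.mem_range.2 hs, rfl⟩
  induction d with
  | zero => simp
  | succ d ih =>
    rw [mul_add, mul_one, Finset.prod_range_add, ih, pow_succ]
    congr 1
    rw [← hone]
    refine Finset.prod_congr rfl fun s _ => ?_
    rw [pow_add, pow_mul, hη.pow_eq_one, one_pow, one_mul]

/-- The matrix of the weighted cyclic shift. -/
def cyclicMatrix {R : Type*} [CommRing R] (i : ℕ) [NeZero i] (a : R) : Matrix (Fin i) (Fin i) R :=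
  Matrix.of fun r s => if s = r + 1 then (if (r : ℕ) + 1 = i then a else 1) else 0

lemma toLin'_cyclicMatrix {R : Type*} [CommRing R] (i : ℕ) [NeZero i] (a : R) :
    Matrix.toLinAlgEquiv' (cyclicMatrix i a) = cyclicShift i a := by
  refine LinearMap.ext fun x => funext fun r => ?_
  rw [cyclicShift_apply, Matrix.toLinAlgEquiv'_apply, Matrix.mulVec, dotProduct]
  simp [cyclicMatrix]

lemma map_cyclicMatrix {R S : Type*} [CommRing R] [CommRing S] (φ : S →+* R) (i : ℕ) [NeZero i]
    (a : S) : φ.mapMatrix (cyclicMatrix i a) = cyclicMatrix i (φ a) := by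
  ext r s
  simp only [cyclicMatrix, RingHom.mapMatrix_apply, Matrix.map_apply, Matrix.of_apply]
  split_ifs <;> simp

/-- Over a field with enough roots, the weighted cyclic shift is diagonalised by the `i`-th roots of
`a`. -/
lemma det_one_sub_cyclicMatrix_pow_of_isAlgClosed {L : Type*} [Field L] [IsAlgClosed L] [CharZero L]
    (i j : ℕ) [NeZero i] {a : L} (ha : a ≠ 0) (b : L) :
    (1 - b • cyclicMatrix i a ^ j).det =
      (1 - a ^ (j / Nat.gcd i j) * b ^ (i / Nat.gcd i j)) ^ Nat.gcd i j := by
  have hi : 0 < i := Nat.pos_of_ne_zero (NeZero.ne i)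
  obtain ⟨α, hα⟩ := IsAlgClosed.exists_pow_nat_eq a hi
  have hα0 : α ≠ 0 := by
    rintro rfl
    exact ha (by rw [← hα, zero_pow hi.ne'])
  have : NeZero (i : L) := ⟨by exact_mod_cast hi.ne'⟩
  obtain ⟨ζ, hζ⟩ := HasEnoughRootsOfUnity.exists_primitiveRoot L i
  let β : Fin i → L := fun s => α * ζ ^ (s : ℕ)
  have hβ : ∀ s, β s ^ i = a := fun s => by
    rw [mul_pow, hα, ← pow_mul, mul_comm (s : ℕ), pow_mul, hζ.pow_eq_one, one_pow, mul_one]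
  have hβinj : Function.Injective β := fun s t hst => by
    have := mul_left_cancel₀ hα0 hst
    exact Fin.ext (hζ.pow_inj s.2 t.2 this)
  let V : Matrix (Fin i) (Fin i) L := (Matrix.vandermonde β).transpose
  have hV : V.det ≠ 0 := by
    rw [Matrix.det_transpose]
    exact Matrix.det_vandermonde_ne_zero_iff.2 hβinj
  have hWV : cyclicMatrix i a * V = V * Matrix.diagonal β := by
    ext r s
    have hsum : ∑ t, cyclicMatrix i a r t * V t s =
        (if (r : ℕ) + 1 = i then a else 1) * V (r + 1) s := by
      simp [cyclicMatrix]
    rw [Matrix.mul_diagonal, Matrix.mul_apply, hsum]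
    change (if (r : ℕ) + 1 = i then a else 1) * β s ^ ((r + 1 : Fin i) : ℕ) = β s ^ (r : ℕ) * β s
    rw [← pow_succ]
    by_cases hr : (r : ℕ) + 1 = i
    · have h0 : ((r + 1 : Fin i) : ℕ) = 0 := by
        rw [Fin.val_add, Fin.val_one', Nat.add_mod_mod, hr, Nat.mod_self]
      rw [if_pos hr, h0, pow_zero, mul_one, hr, hβ]
    · have h0 : ((r + 1 : Fin i) : ℕ) = r + 1 := by
        rw [Fin.val_add, Fin.val_one', Nat.add_mod_mod, Nat.mod_eq_of_lt (by omega)]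
      rw [if_neg hr, one_mul, h0]
  have hpow : ∀ n : ℕ, cyclicMatrix i a ^ n * V = V * Matrix.diagonal β ^ n := by
    intro n
    induction n with
    | zero => simp
    | succ n ih => rw [pow_succ, mul_assoc, hWV, ← mul_assoc, ih, mul_assoc, ← pow_succ]
  have hmain : (1 - b • cyclicMatrix i a ^ j) * V =
      V * Matrix.diagonal fun s => 1 - b * β s ^ j := by
    have hd : Matrix.diagonal (fun s => 1 - b * β s ^ j) = 1 - b • Matrix.diagonal β ^ j := by
      rw [Matrix.diagonal_pow, ← Matrix.diagonal_smul, ← Matrix.diagonal_one, Matrix.diagonal_sub]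
      rfl
    rw [hd, sub_mul, mul_sub, one_mul, mul_one, smul_mul_assoc, hpow, mul_smul_comm]
  have hdet := congrArg Matrix.det hmain
  rw [Matrix.det_mul, Matrix.det_mul, mul_comm, Matrix.det_diagonal] at hdet
  rw [mul_left_cancel₀ hV hdet]
  have hg : 0 < Nat.gcd i j := Nat.gcd_pos_of_pos_left j hi
  have hn : 0 < i / Nat.gcd i j := Nat.div_pos (Nat.gcd_le_left j hi) hg
  have hη : IsPrimitiveRoot (ζ ^ j) (i / Nat.gcd i j) := by
    rw [IsPrimitiveRoot.iff_orderOf,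
      (isOfFinOrder_iff_pow_eq_one.2 ⟨i, hi, hζ.pow_eq_one⟩).orderOf_pow, ← hζ.eq_orderOf]
  have hprod : ∏ s, (1 - b * β s ^ j) =
      ∏ s ∈ Finset.range (i / Nat.gcd i j * Nat.gcd i j), (1 - b * α ^ j * (ζ ^ j) ^ s) := by
    rw [Nat.div_mul_cancel (Nat.gcd_dvd_left i j), ← Fin.prod_univ_eq_prod_range]
    refine Finset.prod_congr rfl fun s _ => ?_
    rw [mul_pow, ← pow_mul, ← pow_mul, mul_comm j, mul_assoc]
  rw [hprod, prod_one_sub_mul_pow hn hη, mul_pow, mul_comm (b ^ _), ← pow_mul]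
  have hexp : j * (i / Nat.gcd i j) = i * (j / Nat.gcd i j) := by
    rw [← Nat.mul_div_assoc _ (Nat.gcd_dvd_left i j), ← Nat.mul_div_assoc _ (Nat.gcd_dvd_right i j),
      mul_comm]
  rw [hexp, pow_mul, hα]

lemma map_det_one_sub_cyclicMatrix_pow {S S' : Type*} [CommRing S] [CommRing S'] (φ : S →+* S')
    (i j : ℕ) [NeZero i] (a b : S) :
    φ (1 - b • cyclicMatrix i a ^ j).det = (1 - φ b • cyclicMatrix i (φ a) ^ j).det := by
  rw [RingHom.map_det, map_sub, map_one, ← map_cyclicMatrix, ← map_pow]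
  congr 2
  ext r s
  simp

/-- The determinant of `1 - b W ^ j` for the weighted cyclic shift `W` of length `i`. It suffices
to treat indeterminates `a`, `b`, which lie in an algebraically closed field. -/
lemma det_one_sub_cyclicMatrix_pow {R : Type*} [CommRing R] (i j : ℕ) [NeZero i] (a b : R) :
    (1 - b • cyclicMatrix i a ^ j).det =
      (1 - a ^ (j / Nat.gcd i j) * b ^ (i / Nat.gcd i j)) ^ Nat.gcd i j := by
  let S := MvPolynomial (Fin 2) ℤ
  let L := AlgebraicClosure (FractionRing S)
  let x : S := MvPolynomial.X 0
  let y : S := MvPolynomial.X 1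
  let ψ : S →+* L := (algebraMap (FractionRing S) L).comp (algebraMap S (FractionRing S))
  have hψ : Function.Injective ψ :=
    (algebraMap (FractionRing S) L).injective.comp (IsFractionRing.injective S (FractionRing S))
  have hψx : ψ x ≠ 0 := by
    rw [map_ne_zero_iff ψ hψ]
    exact MvPolynomial.X_ne_zero 0
  have : CharZero (FractionRing S) :=
    charZero_of_injective_algebraMap (IsFractionRing.injective S (FractionRing S))
  have : CharZero L := charZero_of_injective_algebraMap (algebraMap (FractionRing S) L).injective
  have key : (1 - y • cyclicMatrix i x ^ j).det =
      (1 - x ^ (j / Nat.gcd i j) * y ^ (i / Nat.gcd i j)) ^ Nat.gcd i j := by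
    apply hψ
    rw [map_det_one_sub_cyclicMatrix_pow, det_one_sub_cyclicMatrix_pow_of_isAlgClosed i j hψx]
    simp only [map_pow, map_sub, map_one, map_mul]
  let φ : S →+* R := MvPolynomial.eval₂Hom (Int.castRingHom R) ![a, b]
  have hx : φ x = a := MvPolynomial.eval₂_X _ _ _
  have hy : φ y = b := MvPolynomial.eval₂_X _ _ _
  have h := congrArg φ key
  rw [map_det_one_sub_cyclicMatrix_pow] at h
  simpa only [map_pow, map_sub, map_one, map_mul, hx, hy] using h

lemma det_aeval_cyclicShift {R : Type*} [CommRing R] (i j : ℕ) [NeZero i] (a b : R) :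
    LinearMap.det (aeval (cyclicShift i a) (1 - C b * X ^ j)) =
      (1 - a ^ (j / Nat.gcd i j) * b ^ (i / Nat.gcd i j)) ^ Nat.gcd i j := by
  rw [← det_one_sub_cyclicMatrix_pow, ← toLin'_cyclicMatrix, ← LinearMap.det_toLin']
  congr 1
  rw [map_sub, map_one, map_mul, aeval_C, map_pow, aeval_X, ← Algebra.smul_def, ← map_pow,
    ← map_smul, ← map_one Matrix.toLinAlgEquiv', ← map_sub]
  rfl

end WeightedCycle

/-! ### The symbol of the infinite products -/

section Products

variable {R : Type*} [CommRing R]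

/-- Units of `R[[z]]`, as elements of `R((z))ˣ`. -/
def posUnitOf (u : R⟦X⟧ˣ) : posUnits R :=
  ⟨Units.map (HahnSeries.ofPowerSeries ℤ R : R⟦X⟧ →* R⸨X⸩) u,
    ofPowerSeries_mem R _, ofPowerSeries_mem R _⟩

lemma coe_posUnitOf (u : R⟦X⟧ˣ) :
    ((posUnitOf u).1 : R⸨X⸩) = HahnSeries.ofPowerSeries ℤ R (u : R⟦X⟧) := rfl

lemma posUnitOf_mul (u v : R⟦X⟧ˣ) : posUnitOf (u * v) = posUnitOf u * posUnitOf v :=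
  Subtype.ext (map_mul _ u v)

lemma posUnitOf_prod {ι : Type*} (s : Finset ι) (u : ι → R⟦X⟧ˣ) :
    posUnitOf (∏ i ∈ s, u i) = ∏ i ∈ s, posUnitOf (u i) :=
  map_prod (MonoidHom.mk' posUnitOf posUnitOf_mul) u s

/-- Units of `R[w]`, evaluated at `w = z⁻¹`. -/
def negUnitOf (v : R[X]ˣ) : negUnits R :=
  ⟨Units.map (evalInv (R := R)).toMonoidHom v, evalInv_mem_negSubring (v : R[X]),
    evalInv_mem_negSubring (↑v⁻¹ : R[X])⟩

lemma coe_negUnitOf (v : R[X]ˣ) : ((negUnitOf v).1 : R⸨X⸩) = evalInv (v : R[X]) := rfl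

/-- The polynomial `∏ (1 - b̄ j w ^ j)`. -/
def negPoly (bbar : ℕ+ →₀ R) : R[X] := ∏ j ∈ bbar.support, (1 - C (bbar j) * X ^ (j : ℕ))

lemma isUnit_negPoly {bbar : ℕ+ →₀ R} (h : ∀ j, IsNilpotent (bbar j)) : IsUnit (negPoly bbar) := by
  refine Finset.prod_induction _ IsUnit (fun _ _ => IsUnit.mul) isUnit_one fun j _ => ?_
  apply IsNilpotent.isUnit_one_sub
  exact (Commute.all _ _).isNilpotent_mul_right ((h j).map C)

lemma evalInv_negPoly (bbar : ℕ+ →₀ R) :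
    evalInv (negPoly bbar) =
      ∏ j ∈ bbar.support, (1 - HahnSeries.single (-((j : ℕ) : ℤ)) (bbar j) : R⸨X⸩) := by
  rw [negPoly, map_prod]
  refine Finset.prod_congr rfl fun j _ => ?_
  rw [map_sub, map_one, map_mul, evalInv_C, evalInv_X_pow, HahnSeries.single_mul_single, zero_add,
    mul_one]

lemma det_aeval_negPoly (bbar : ℕ+ →₀ R) (i : ℕ+) (a : ℕ → R) :
    LinearMap.det (aeval (cyclicShift (i : ℕ) (a i)) (negPoly bbar)) =
      ∏ j ∈ bbar.support, symbolFactor a bbar (i, j) := by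
  let D : R[X] →* R := (LinearMap.det : ((Fin i → R) →ₗ[R] (Fin i → R)) →* R).comp
    (aeval (cyclicShift (i : ℕ) (a i)) : R[X] →ₐ[R] Module.End R (Fin i → R))
  change D (negPoly bbar) = _
  rw [negPoly, map_prod]
  exact Finset.prod_congr rfl fun j _ => det_aeval_cyclicShift i j (a i) (bbar j)

lemma symbolFactor_zero (bbar : ℕ+ →₀ R) (p : ℕ+ × ℕ+) : symbolFactor 0 bbar p = 1 := by
  have h : (p.2 : ℕ) / Nat.gcd p.1 p.2 ≠ 0 :=
    (Nat.div_pos (Nat.gcd_le_right _ p.2.pos) (Nat.gcd_pos_of_pos_left _ p.1.pos)).ne'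
  rw [symbolFactor, Pi.zero_apply, zero_pow h, zero_mul, sub_zero, one_pow]

lemma symbolExponent_ne_zero (p : ℕ+ × ℕ+) : (p.1 : ℕ) / Nat.gcd p.1 p.2 ≠ 0 :=
  (Nat.div_pos (Nat.gcd_le_left _ p.1.pos) (Nat.gcd_pos_of_pos_left _ p.1.pos)).ne'

lemma isUnit_symbolFactor (a : ℕ → R) {bbar : ℕ+ →₀ R} (h : ∀ j, IsNilpotent (bbar j))
    (p : ℕ+ × ℕ+) : IsUnit (symbolFactor a bbar p) := by
  refine (IsNilpotent.isUnit_one_sub ?_).pow _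
  exact (Commute.all _ _).isNilpotent_mul_left ((h p.2).pow_of_pos (symbolExponent_ne_zero p))

/-- The factors with index `i` large are trivial, since then a large power of some `b̄ j` occurs. -/
lemma exists_symbolFactor_eq_one (a : ℕ → R) {bbar : ℕ+ →₀ R} (h : ∀ j, IsNilpotent (bbar j)) :
    ∃ n : ℕ, ∀ p : ℕ+ × ℕ+, (n < p.1 ∨ p.2 ∉ bbar.support) → symbolFactor a bbar p = 1 := by
  choose L hL using h
  refine ⟨∑ j ∈ bbar.support, L j * j, fun p hp => ?_⟩
  have key : bbar p.2 ^ ((p.1 : ℕ) / Nat.gcd p.1 p.2) = 0 := by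
    by_cases hmem : p.2 ∈ bbar.support
    · refine pow_eq_zero_of_le ?_ (hL p.2)
      rw [Nat.le_div_iff_mul_le (Nat.gcd_pos_of_pos_left _ p.1.pos)]
      have h₁ : L p.2 * p.2 ≤ ∑ j ∈ bbar.support, L j * (j : ℕ) :=
        Finset.single_le_sum (f := fun j : ℕ+ => L j * (j : ℕ)) (fun _ _ => Nat.zero_le _) hmem
      have h₂ : L p.2 * Nat.gcd p.1 p.2 ≤ L p.2 * p.2 :=
        Nat.mul_le_mul_left _ (Nat.gcd_le_right _ p.2.pos)
      have h₃ := hp.resolve_right (not_not.2 hmem)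
      omega
    · rw [Finsupp.notMem_support_iff.1 hmem, zero_pow (symbolExponent_ne_zero p)]
  rw [symbolFactor, key, mul_zero, sub_zero, one_pow]

lemma finprod_symbolFactor {a : ℕ → R} {bbar : ℕ+ →₀ R} {n : ℕ}
    (hn : ∀ p : ℕ+ × ℕ+, (n < p.1 ∨ p.2 ∉ bbar.support) → symbolFactor a bbar p = 1) :
    (Function.mulSupport (symbolFactor a bbar)).Finite ∧
      ∏ᶠ p, symbolFactor a bbar p = ∏ i ∈ Finset.range n, ∏ j ∈ bbar.support,
        symbolFactor a bbar (i.succPNat, j) := by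
  classical
  have hsub : Function.mulSupport (symbolFactor a bbar) ⊆
      (((Finset.range n).image Nat.succPNat ×ˢ bbar.support : Finset (ℕ+ × ℕ+)) :
        Set (ℕ+ × ℕ+)) := by
    intro p hp
    have h : ¬ (n < p.1 ∨ p.2 ∉ bbar.support) := fun h => hp (hn p h)
    push Not at h
    refine Finset.mem_coe.2 (Finset.mem_product.2 ⟨?_, h.2⟩)
    refine Finset.mem_image.2 ⟨p.1.natPred, Finset.mem_range.2 ?_, PNat.succPNat_natPred p.1⟩
    have := PNat.natPred_add_one p.1
    omega
  refine ⟨(Finset.finite_toSet _).subset hsub, ?_⟩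
  rw [finprod_eq_prod_of_mulSupport_subset _ hsub, Finset.prod_product,
    Finset.prod_image fun i _ j _ h => Nat.succPNat_injective h]

/-- The finite products `∏_{i < n} (1 - a i z ^ i)`. -/
def partialProduct (a : ℕ → R) (n : ℕ) : R⟦X⟧ :=
  ∏ i ∈ Finset.range n, (1 - PowerSeries.C (a i) * PowerSeries.X ^ i)

lemma isUnit_one_sub_monomial {a : ℕ → R} (h : IsUnit (1 - a 0)) (i : ℕ) :
    IsUnit (1 - PowerSeries.C (a i) * PowerSeries.X ^ i : R⟦X⟧) := by
  rw [PowerSeries.isUnit_iff_constantCoeff]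
  cases i with
  | zero => simpa using h
  | succ i => simp

lemma coeff_partialProduct (a : ℕ → R) {m n : ℕ} (h : m < n) :
    PowerSeries.coeff m (partialProduct a n) = PowerSeries.coeff m (posProduct a) := by
  induction n, h using Nat.le_induction with
  | base => rw [posProduct, PowerSeries.coeff_mk]; rfl
  | succ n hn ih =>
    rw [← ih, partialProduct, Finset.prod_range_succ, mul_sub, mul_one, map_sub, ← mul_assoc,
      PowerSeries.coeff_mul_X_pow', if_neg (by omega), sub_zero]
    rfl

lemma isUnit_posProduct {a : ℕ → R} (h : IsUnit (1 - a 0)) : IsUnit (posProduct a) := by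
  rw [PowerSeries.isUnit_iff_constantCoeff, ← PowerSeries.coeff_zero_eq_constantCoeff_apply,
    ← coeff_partialProduct a Nat.zero_lt_one]
  simpa [partialProduct] using h

/-- An infinite product is a finite one, up to a unit congruent to `1` modulo `z ^ n`. -/
lemma exists_posUnitOf_eq_mul_prod {a : ℕ → R} {u : R⟦X⟧ˣ}
    (hu : (u : R⟦X⟧) = posProduct a) {w : ℕ → R⟦X⟧ˣ}
    (hw : ∀ i, (w i : R⟦X⟧) = 1 - PowerSeries.C (a i) * PowerSeries.X ^ i) (n : ℕ) :
    ∃ t : R⟦X⟧ˣ,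
      posUnitOf u = posUnitOf t * posUnitOf (w 0) *
        ∏ i ∈ Finset.range n, posUnitOf (w (i + 1)) ∧
      ((posUnitOf t).1 : R⸨X⸩) - 1 ∈ lattice R R ((n : ℕ) : ℤ) := by
  have hwprod : ((∏ i ∈ Finset.range (n + 1), w i : R⟦X⟧ˣ) : R⟦X⟧) = partialProduct a (n + 1) := by
    rw [Units.coe_prod, partialProduct]
    exact Finset.prod_congr rfl fun i _ => hw i
  refine ⟨(∏ i ∈ Finset.range (n + 1), w i)⁻¹ * u, ?_, ?_⟩
  · rw [← posUnitOf_prod, ← posUnitOf_mul, ← posUnitOf_mul]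
    congr 1
    rw [mul_assoc, mul_comm (w 0), ← Finset.prod_range_succ' w n, mul_right_comm, inv_mul_cancel,
      one_mul]
  · have hdvd : (PowerSeries.X : R⟦X⟧) ^ n ∣
        (((∏ i ∈ Finset.range (n + 1), w i)⁻¹ * u : R⟦X⟧ˣ) : R⟦X⟧) - 1 := by
      have hfac : (((∏ i ∈ Finset.range (n + 1), w i)⁻¹ * u : R⟦X⟧ˣ) : R⟦X⟧) - 1 =
          (↑(∏ i ∈ Finset.range (n + 1), w i)⁻¹ : R⟦X⟧) *
            (posProduct a - partialProduct a (n + 1)) := by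
        rw [mul_sub, ← hu, ← hwprod, Units.inv_mul, ← Units.val_mul]
      rw [hfac]
      refine Dvd.dvd.mul_left (PowerSeries.X_pow_dvd_iff.2 fun m hm => ?_) _
      rw [map_sub, coeff_partialProduct a (by omega), sub_self]
    rw [coe_posUnitOf, ← map_one (HahnSeries.ofPowerSeries ℤ R), ← map_sub]
    intro m hm
    by_cases hm0 : m < 0
    · exact ofPowerSeries_mem R _ m hm0
    · lift m to ℕ using not_lt.1 hm0
      rw [HahnSeries.ofPowerSeries_apply_coeff]
      exact PowerSeries.X_pow_dvd_iff.1 hdvd m (by exact_mod_cast hm)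

end Products

section Symbol

variable {K : Type*} [CommRing K] {R : Type*} [CommRing R] [Algebra K R]

lemma hasSymbol_monomial [Module.Free K R] [Module.Finite K R] {a : ℕ → R} {bbar : ℕ+ →₀ R}
    {v : R[X]ˣ} (hv : (v : R[X]) = negPoly bbar) (i : ℕ+) {u : R⟦X⟧ˣ}
    (hu : (u : R⟦X⟧) = 1 - PowerSeries.C (a i) * PowerSeries.X ^ (i : ℕ)) :
    HasSymbol (posUnitOf u) (negUnitOf v)
      (Algebra.norm K (∏ j ∈ bbar.support, symbolFactor a bbar (i, j))) := by
  rw [← det_aeval_negPoly]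
  apply hasSymbol_one_sub_single
  · rw [coe_posUnitOf, hu, map_sub, map_one, map_mul, HahnSeries.ofPowerSeries_C,
      HahnSeries.ofPowerSeries_X_pow, HahnSeries.C_apply, HahnSeries.single_mul_single, zero_add,
      mul_one]
  · rw [coe_negUnitOf, hv]
  · exact (det_aeval_negPoly bbar i 0).trans
      (Finset.prod_eq_one fun j _ => symbolFactor_zero bbar (i, j))

/-- The symbol of the infinite product is computed from its factors with `0 < i ≤ n`: the constant
factor has trivial symbol, and so has the tail for large `n`. -/
lemma hasSymbol_posProduct [Module.Free K R] [Module.Finite K R] {a : ℕ → R} (h0 : IsUnit (1 - a 0))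
    {bbar : ℕ+ →₀ R} (hb : ∀ j, IsNilpotent (bbar j)) {u : R⟦X⟧ˣ} {v : R[X]ˣ}
    (hu : (u : R⟦X⟧) = posProduct a) (hv : (v : R[X]) = negPoly bbar) :
    HasSymbol (posUnitOf u) (negUnitOf v) (Algebra.norm K (∏ᶠ p, symbolFactor a bbar p)) := by
  obtain ⟨n₁, hn₁⟩ := exists_symbolFactor_eq_one a hb
  obtain ⟨n₂, hn₂⟩ := exists_hasSymbol_one_of_congr (K := K) (negUnitOf v)
  obtain ⟨n, hn, hn'⟩ : ∃ n, n₁ ≤ n ∧ n₂ ≤ n := ⟨max n₁ n₂, le_max_left _ _, le_max_right _ _⟩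
  choose w hw using fun i => isUnit_one_sub_monomial h0 i
  obtain ⟨t, hut, ht⟩ := exists_posUnitOf_eq_mul_prod hu hw n
  have h₁ : HasSymbol (K := K) (posUnitOf t) (negUnitOf v) 1 := hn₂ n hn' (posUnitOf t) ht
  have h₂ : HasSymbol (K := K) (posUnitOf (w 0)) (negUnitOf v) 1 := by
    apply hasSymbol_of_mem_negSubring
    rw [coe_posUnitOf, hw, pow_zero, mul_one, map_sub, map_one, HahnSeries.ofPowerSeries_C]
    exact sub_mem (one_mem _) (single_mem_negSubring le_rfl _)
  have h₃ : ∀ i : ℕ, HasSymbol (posUnitOf (w (i + 1))) (negUnitOf v)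
      (Algebra.norm K (∏ j ∈ bbar.support, symbolFactor a bbar (i.succPNat, j))) :=
    fun i => hasSymbol_monomial hv i.succPNat (hw (i + 1))
  have h₄ : HasSymbol (∏ i ∈ Finset.range n, posUnitOf (w (i + 1))) (negUnitOf v)
      (∏ i ∈ Finset.range n,
        Algebra.norm K (∏ j ∈ bbar.support, symbolFactor a bbar (i.succPNat, j))) :=
    HasSymbol.prod (Finset.range n) fun i _ => h₃ i
  have h₅ : HasSymbol (posUnitOf u) (negUnitOf v) (1 * 1 * ∏ i ∈ Finset.range n,
      Algebra.norm K (∏ j ∈ bbar.support, symbolFactor a bbar (i.succPNat, j))) := by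
    rw [hut]
    exact (h₁.mul h₂).mul h₄
  rwa [one_mul, one_mul, ← map_prod,
    ← (finprod_symbolFactor fun p hp => hn₁ p (hp.imp_left hn.trans_lt)).2] at h₅

end Symbol

end ContouCarrere

end

theorem propositionp {k : Type*} {R : Type*} [Field k] [CommRing R] [Algebra k R]
    [IsLocalRing R] [IsArtinianRing R] [Module.Finite k R]
    (a b : ℕ → R) (abar bbar : ℕ+ →₀ R)
    (ha : ∀ i, a i ∈ IsLocalRing.maximalIdeal R) (hb : ∀ i, b i ∈ IsLocalRing.maximalIdeal R)
    (habar : ∀ i, IsNilpotent (abar i)) (hbbar : ∀ i, IsNilpotent (bbar i))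
    (f g : (LaurentSeries R)ˣ)
    (hf : (f : LaurentSeries R) = ContouCarrere.laurentProduct abar a)
    (hg : (g : LaurentSeries R) = ContouCarrere.laurentProduct bbar b) :
    (Function.mulSupport (ContouCarrere.symbolFactor a bbar)).Finite ∧
    (Function.mulSupport (ContouCarrere.symbolFactor b abar)).Finite ∧
    ∃ P Q : Rˣ,
      (P : R) = ∏ᶠ p : ℕ+ × ℕ+, ContouCarrere.symbolFactor a bbar p ∧
      (Q : R) = ∏ᶠ p : ℕ+ × ℕ+, ContouCarrere.symbolFactor b abar p ∧
      ContouCarrere.IsCommutator R f g (P / Q) ∧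
      ContouCarrere.IsCommutator k f g (Units.map (Algebra.norm k) (P / Q)) := by
  open ContouCarrere in
  have hunit : ∀ c : ℕ → R, (∀ i, c i ∈ IsLocalRing.maximalIdeal R) → IsUnit (1 - c 0) :=
    fun c hc => IsLocalRing.isUnit_one_sub_self_of_mem_nonunits _
      ((IsLocalRing.mem_maximalIdeal _).1 (hc 0))
  obtain ⟨n, hn⟩ := exists_symbolFactor_eq_one a hbbar
  obtain ⟨n', hn'⟩ := exists_symbolFactor_eq_one b habar
  have hPunit : IsUnit (∏ᶠ p, symbolFactor a bbar p) :=
    finprod_induction IsUnit isUnit_one (fun _ _ => IsUnit.mul) (isUnit_symbolFactor a hbbar)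
  have hQunit : IsUnit (∏ᶠ p, symbolFactor b abar p) :=
    finprod_induction IsUnit isUnit_one (fun _ _ => IsUnit.mul) (isUnit_symbolFactor b habar)
  obtain ⟨P, hP⟩ := hPunit
  obtain ⟨Q, hQ⟩ := hQunit
  obtain ⟨u, hu⟩ := isUnit_posProduct (hunit a ha)
  obtain ⟨u', hu'⟩ := isUnit_posProduct (hunit b hb)
  obtain ⟨v, hv⟩ := isUnit_negPoly habar
  obtain ⟨v', hv'⟩ := isUnit_negPoly hbbar
  have hf' : f = (negUnitOf v).1 * (posUnitOf u).1 := by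
    apply Units.ext
    rw [hf, Units.val_mul, coe_negUnitOf, coe_posUnitOf, hv, hu, evalInv_negPoly, laurentProduct]
  have hg' : g = (negUnitOf v').1 * (posUnitOf u').1 := by
    apply Units.ext
    rw [hg, Units.val_mul, coe_negUnitOf, coe_posUnitOf, hv', hu', evalInv_negPoly, laurentProduct]
  have hK : IsCommutator k f g (Units.map (Algebra.norm k) (P / Q)) := by
    rw [hf', hg', map_div]
    apply isCommutator_of_hasSymbol
    · rw [Units.coe_map, hP]
      exact hasSymbol_posProduct (hunit a ha) hbbar hu hv'
    · rw [Units.coe_map, hQ]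
      exact hasSymbol_posProduct (hunit b hb) habar hu' hv
  have hR : IsCommutator R f g (P / Q) := by
    rw [hf', hg']
    apply isCommutator_of_hasSymbol
    · have h := hasSymbol_posProduct (K := R) (hunit a ha) hbbar hu hv'
      rwa [← hP, Algebra.norm_self, MonoidHom.id_apply] at h
    · have h := hasSymbol_posProduct (K := R) (hunit b hb) habar hu' hv
      rwa [← hQ, Algebra.norm_self, MonoidHom.id_apply] at h
  exact ⟨(finprod_symbolFactor hn).1, (finprod_symbolFactor hn').1, P, Q, hP, hQ, hR, hK⟩
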